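/- Let $C_{\mathbb Z}$ be one of the split composition rings over $\mathbb Z$: the binarions $\mathbb B_{\mathbb Z}=\{\mathrm{diag}(a,d)\}\subset M_2(\mathbb Z)$, the quaternions $\mathbb H_{\mathbb Z}=M_2(\mathbb Z)$ (norm $\det$, conjugation the adjugate), or the octonions $\mathbb O_{\mathbb Z}=\mathbb H_{\mathbb Z}\oplus\mathbb H_{\mathbb Z}v$ with $(a+bv)(c+dv)=(ac-\bar d b)+(da+b\bar c)v$, $n(a+bv)=\det a+\det b$ and $\overline{a+bv}=\bar a-bv$. Let $J=H_3(C_{\mathbb Z})$ be the module of Hermitian $3\times 3$ matrices $$A=\begin{pmatrix}a&z&\bar y\\ \bar z&b&x\\ y&\bar x&c\end{pmatrix},\qquad a,b,c\in\mathbb Z,\quad x,y,z\in C_{\mathbb Z},$$ with cubic norm $N(A)=abc-a\,n(x)-b\,n(y)-c\,n(z)+(xy)z+\overline{(xy)z}$, trace form $(A,B)=\mathrm{Tr}\,\tfrac12(AB+BA)$ and adjoint matrix $A^\#$, whose diagonal entries are $bc-n(x)$, $ac-n(y)$, $ab-n(z)$ and whose entries in positions $(2,3)$, $(3,1)$, $(1,2)$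 are $\overline{yz}-ax$, $\overline{zx}-by$, $\overline{xy}-cz$. Put $M(J)=\mathbb Z\oplus\mathbb Z\oplus J\oplus J$, with the quartic norm and the skew-symmetric form $$q'(\alpha,\beta,A,B)=-4(A^\#,B^\#)+4\alpha N(A)+4\beta N(B)+\bigl((A,B)-\alpha\beta\bigr)^2,$$ $$\{(\alpha,\beta,A,B),(\gamma,\delta,C,D)\}=\alpha\delta-\beta\gamma+(A,D)-(B,C),$$ and let $G(M(J))$ be the group of invertible $\mathbb Z$-linear transformations of $M(J)$ that preserve $q'$ and $\{\cdot,\cdot\}$. An element of $M(J)$ is called projective if its $G(M(J))$-orbit contains an element $(\alpha,\beta,\mathrm{diag}(a_1,a_2,a_3),0)$ with $\alpha>0$, $\alpha\mid\beta$, $\alpha\mid a_i$ such that $$\gcd(\alpha a_1,\alpha\beta,a_2a_3)=\gcd(\alpha a_2,\alpha\beta,a_3a_1)=\gcd(\alpha a_3,\alpha\beta,a_1a_2)=1.$$ For $C=\mathbb B$, identify $J$ with $M_3(\mathbb Z)$ by sending $A$ to the matrix with the same diagonal entries as $A$ whose $(i,j)$ and $(j,i)$ entries, $i<j$, are the first and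 the second diagonal entry of the binarion in position $(i,j)$ of $A$. Let $e_1,e_2,e_3,f_1,f_2,f_3$ be the standard basis of $\mathbb Z^6$ and identify $M(J)$ with $\wedge^3\mathbb Z^6$ by $$(1,0,0,0)\mapsto e_1\wedge e_2\wedge e_3,\quad (0,1,0,0)\mapsto f_1\wedge f_2\wedge f_3,\quad (0,0,E_{ij},0)\mapsto e_i\wedge f_{j+1}\wedge f_{j+2},\quad (0,0,0,E_{ij})\mapsto f_i\wedge e_{j+1}\wedge e_{j+2}$$ (indices modulo $3$); this defines $q'$ and projective elements on $\wedge^3\mathbb Z^6$. Theorem. Let $(G_{\mathbb Z},M_{\mathbb Z})$ be one of the pairs - $(\mathrm{SL}_6(\mathbb Z),\wedge^3\mathbb Z^6)$ with the natural action, - $(D_6(\mathbb Z),\text{half-spin}_{\mathbb Z})$, that is, $(G(M(J)),M(J))$ for $J=H_3(\mathbb H_{\mathbb Z})$, - $(E_7(\mathbb Z),V(\omega_7)_{\mathbb Z})$, that is, $(G(M(J)),M(J))$ for $J=H_3(\mathbb O_{\mathbb Z})$. Then: 1. The norm $q'$ on $M_{\mathbb Z}$ is $G_{\mathbb Z}$-invariant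 and takes only values congruent to $0$ or $1$ modulo $4$. 2. For every integer $n\equiv 0$ or $1\pmod 4$, the group $G_{\mathbb Z}$ acts transitively on the (non-empty) set of projective elements of norm $n$. 3. If $n$ is a fundamental discriminant (that is, $n$ is squarefree and $n\equiv 1\pmod 4$, the case $n=1$ included, or $n=4k$ with $k$ squarefree and $k\equiv 2$ or $3\pmod 4$), then every element of $M_{\mathbb Z}$ of norm $n$ is projective, and hence $G_{\mathbb Z}$ acts transitively on the set of elements of norm $n$. -/

import Mathlib

open scoped MatrixGroups

/-! ### Split composition rings over `ℤ` -/

/-- The operations of a composition ring over `ℤ`: product, conjugation, norm and trace. -/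
class CompOps (C : Type) where
  mul : C → C → C
  conj : C → C
  norm : C → ℤ
  tr : C → ℤ

/-- Split binarions: the diagonal matrices `diag(a, d)`, written as pairs `(a, d)`. -/
abbrev BinZ : Type := ℤ × ℤ

/-- Split quaternions: integral `2 × 2` matrices. -/
abbrev QuatZ : Type := Matrix (Fin 2) (Fin 2) ℤ

/-- Split octonions: `(a, b)` stands for `a + b v` with quaternions `a`, `b`. -/
abbrev OctZ : Type := QuatZ × QuatZ

instance instCompOpsBinZ : CompOps BinZ where
  mul x y := (x.1 * y.1, x.2 * y.2)
  conj x := (x.2, x.1)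
  norm x := x.1 * x.2
  tr x := x.1 + x.2

/-- The conjugate of `!![a, b; c, d]` is the adjugate `!![d, -b; -c, a]`. -/
instance instCompOpsQuatZ : CompOps QuatZ where
  mul x y := x * y
  conj x := x.adjugate
  norm x := x.det
  tr x := x.trace

/-- `(a + b v) (c + d v) = (a c - conj d * b) + (d a + b * conj c) v`. -/
instance instCompOpsOctZ : CompOps OctZ where
  mul x y := (x.1 * y.1 - y.2.adjugate * x.2, y.2 * x.1 + x.2 * y.1.adjugate)
  conj x := (x.1.adjugate, -x.2)
  norm x := x.1.det + x.2.det
  tr x := x.1.trace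

/-! ### Hermitian `3 × 3` matrices -/

/-- Hermitian `3 × 3` matrices over `C`. The pair `(d, u)` with `d = (a, b, c)` and
`u = (x, y, z)` is the matrix with rows `(a, z, conj y)`, `(conj z, b, x)`, `(y, conj x, c)`. -/
abbrev Herm3 (C : Type) : Type := (Fin 3 → ℤ) × (Fin 3 → C)

namespace Herm3

variable {C : Type} [CompOps C]

/-- The cubic norm `a b c - a n(x) - b n(y) - c n(z) + ((x y) z + conj ((x y) z))`. -/
def cubicNorm (A : Herm3 C) : ℤ :=
  A.1 0 * A.1 1 * A.1 2
    - A.1 0 * CompOps.norm (A.2 0) - A.1 1 * CompOps.norm (A.2 1) - A.1 2 * CompOps.norm (A.2 2)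
    + CompOps.tr (CompOps.mul (CompOps.mul (A.2 0) (A.2 1)) (A.2 2))

/-- The trace bilinear form, i.e. the matrix trace of `(A B + B A) / 2`. -/
def tracePair (A B : Herm3 C) : ℤ :=
  ∑ i, A.1 i * B.1 i + ∑ i, CompOps.tr (CompOps.mul (A.2 i) (CompOps.conj (B.2 i)))

/-- The adjoint matrix `A^#`; indices are cyclic modulo `3`. -/
def sharp [AddCommGroup C] (A : Herm3 C) : Herm3 C :=
  (fun i => A.1 (i + 1) * A.1 (i + 2) - CompOps.norm (A.2 i),
   fun i => CompOps.conj (CompOps.mul (A.2 (i + 1)) (A.2 (i + 2))) - A.1 i • A.2 i)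

end Herm3

/-! ### The integral Freudenthal module and its group -/

/-- The Freudenthal module of `Herm3 C`; an element is a quadruple `(α, β, A, B)`. -/
abbrev FModule (C : Type) : Type := ℤ × ℤ × Herm3 C × Herm3 C

namespace FModule

variable {C : Type} [CompOps C]

/-- The skew-symmetric form
`{(α, β, A, B), (γ, δ, C, D)} = α δ - β γ + (A, D) - (B, C)`. -/
def symp : FModule C → FModule C → ℤ
  | (α, β, A, B), (γ, δ, A', B') =>
    α * δ - β * γ + Herm3.tracePair A B' - Herm3.tracePair B A'

/-- The quartic norm `q'(α, β, A, B) =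
-4 (A^#, B^#) + 4 α N(A) + 4 β N(B) + ((A, B) - α β)^2`. -/
def quartic [AddCommGroup C] : FModule C → ℤ
  | (α, β, A, B) =>
    -4 * Herm3.tracePair A.sharp B.sharp + 4 * α * A.cubicNorm + 4 * β * B.cubicNorm
      + (Herm3.tracePair A B - α * β) ^ 2

end FModule

/-- The group of invertible `ℤ`-linear transformations of the Freudenthal module which preserve
the quartic form and the skew-symmetric form. -/
def FGroup (C : Type) [CompOps C] [AddCommGroup C] :
    Subgroup (FModule C ≃ₗ[ℤ] FModule C) where
  carrier := {g | (∀ x, (g x).quartic = x.quartic) ∧ ∀ x y, (g x).symp (g y) = x.symp y}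
  mul_mem' := by
    rintro g h ⟨hg1, hg2⟩ ⟨hh1, hh2⟩
    exact ⟨fun x => (hg1 (h x)).trans (hh1 x), fun x y => (hg2 (h x) (h y)).trans (hh2 x y)⟩
  one_mem' := ⟨fun _ => rfl, fun _ _ => rfl⟩
  inv_mem' := by
    rintro g ⟨hg1, hg2⟩
    refine ⟨fun x => ?_, fun x y => ?_⟩
    · have h := hg1 (g.symm x)
      rw [LinearEquiv.apply_symm_apply] at h
      exact h.symm
    · have h := hg2 (g.symm x) (g.symm y)
      rw [LinearEquiv.apply_symm_apply, LinearEquiv.apply_symm_apply] at h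
      exact h.symm

/-- The tautological representation of `FGroup C` on the Freudenthal module. -/
def FGroup.rep (C : Type) [CompOps C] [AddCommGroup C] :
    Representation ℤ (FGroup C) (FModule C) where
  toFun g := (g : FModule C ≃ₗ[ℤ] FModule C).toLinearMap
  map_one' := rfl
  map_mul' _ _ := rfl

/-! ### Projective elements -/

/-- Projectivity of the element `(α, β, (a₁, a₂, a₃), (b₁, b₂, b₃))` of the Freudenthal module of
`ℤ ⊕ ℤ ⊕ ℤ`: each of the three binary quadratic forms
`(α aᵢ - bⱼ bₖ) X² + (a·b - 2 aᵢ bᵢ - α β) X Y + (β bᵢ - aⱼ aₖ) Y²`, with `{i, j, k} = {1, 2, 3}`,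
is primitive. -/
def CubeProjective (α β : ℤ) (a b : Fin 3 → ℤ) : Prop :=
  ∀ i : Fin 3, Int.gcd (Int.gcd (α * a i - b (i + 1) * b (i + 2))
    (-(a i * b i) + a (i + 1) * b (i + 1) + a (i + 2) * b (i + 2) - α * β))
    (β * b i - a (i + 1) * a (i + 2)) = 1

/-- An element is projective if its orbit contains a diagonal reduced element
`(α, β, diag(a₁, a₂, a₃), 0)`, `α > 0`, `α ∣ β`, `α ∣ aᵢ`, which is projective as an element of
the Freudenthal module of `ℤ ⊕ ℤ ⊕ ℤ`. -/
def FModule.IsProjective {C : Type} [CompOps C] [AddCommGroup C] (x : FModule C) : Prop :=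
  ∃ g ∈ FGroup C, ∃ (α β : ℤ) (a : Fin 3 → ℤ),
    g x = (α, β, (a, 0), 0) ∧ 0 < α ∧ α ∣ β ∧ (∀ i, α ∣ a i) ∧ CubeProjective α β a 0

/-! ### `SL₆(ℤ)` acting on `⋀³ ℤ⁶` -/

/-- The third exterior power of `ℤ⁶`. -/
abbrev Wedge3 : Type := ⋀[ℤ]^3 (Fin 6 → ℤ)

/-- The natural action of `SL₆(ℤ)` on `⋀³ ℤ⁶`. -/
noncomputable def wedgeRep : Representation ℤ SL(6, ℤ) Wedge3 where
  toFun g := exteriorPower.map 3 (Matrix.toLin' (g : Matrix (Fin 6) (Fin 6) ℤ))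
  map_one' := by
    rw [Matrix.SpecialLinearGroup.coe_one, Matrix.toLin'_one, exteriorPower.map_id]
    rfl
  map_mul' g h := by
    rw [Matrix.SpecialLinearGroup.coe_mul, Matrix.toLin'_mul, Module.End.mul_eq_comp]
    rw [exteriorPower.map_comp]

/-- The `3 × 3` integer matrix corresponding to a Hermitian matrix of binarions. -/
def Herm3.toMat (A : Herm3 BinZ) : Matrix (Fin 3) (Fin 3) ℤ :=
  !![A.1 0, (A.2 2).1, (A.2 1).2;
     (A.2 2).2, A.1 1, (A.2 0).1;
     (A.2 1).1, (A.2 0).2, A.1 2]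

/-- `v i ∧ v j ∧ v k` for the standard basis `v` of `ℤ⁶`. -/
noncomputable def stdWedge (i j k : Fin 6) : Wedge3 :=
  exteriorPower.ιMulti ℤ 3 ![Pi.single i (1 : ℤ), Pi.single j 1, Pi.single k 1]

/-- The index in `ℤ⁶` of the vector `e i` of the basis `e₁, e₂, e₃, f₁, f₂, f₃`. -/
def eIdx (i : Fin 3) : Fin 6 := Fin.castAdd 3 i

/-- The index in `ℤ⁶` of the vector `f i` of the basis `e₁, e₂, e₃, f₁, f₂, f₃`. -/
def fIdx (i : Fin 3) : Fin 6 := Fin.natAdd 3 i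

/-- The map sending `(1, 0, 0, 0)` to `e₁ ∧ e₂ ∧ e₃`, `(0, 1, 0, 0)` to `f₁ ∧ f₂ ∧ f₃`,
`(0, 0, E i j, 0)` to `e i ∧ f (j + 1) ∧ f (j + 2)` and
`(0, 0, 0, E i j)` to `f i ∧ e (j + 1) ∧ e (j + 2)`. -/
noncomputable def thetaLin : FModule BinZ →ₗ[ℤ] Wedge3 where
  toFun x :=
    x.1 • stdWedge (eIdx 0) (eIdx 1) (eIdx 2) + x.2.1 • stdWedge (fIdx 0) (fIdx 1) (fIdx 2)
    + ∑ i, ∑ j, x.2.2.1.toMat i j • stdWedge (eIdx i) (fIdx (j + 1)) (fIdx (j + 2))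
    + ∑ i, ∑ j, x.2.2.2.toMat i j • stdWedge (fIdx i) (eIdx (j + 1)) (eIdx (j + 2))
  map_add' x y := by
    have h : ∀ A B : Herm3 BinZ, (A + B).toMat = A.toMat + B.toMat := by
      intro A B
      ext i j
      fin_cases i <;> fin_cases j <;> simp [Herm3.toMat]
    simp only [Prod.fst_add, Prod.snd_add, h, Matrix.add_apply, add_smul,
      Finset.sum_add_distrib]
    abel
  map_smul' c x := by
    have h : ∀ A : Herm3 BinZ, (c • A).toMat = c • A.toMat := by
      intro A
      ext i j
      fin_cases i <;> fin_cases j <;> simp [Herm3.toMat]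
    simp only [Prod.smul_fst, Prod.smul_snd, h, Matrix.smul_apply, smul_assoc,
      ← Finset.smul_sum, smul_add, RingHom.id_apply]

/-- The coordinate function on `⋀³ ℤ⁶` dual to `stdWedge i j k`. -/
noncomputable def wedgeCoord (i j k : Fin 6) : Wedge3 →ₗ[ℤ] ℤ :=
  exteriorPower.alternatingMapLinearEquiv
    ((Matrix.detRowAlternating (n := Fin 3) (R := ℤ)).compLinearMap
      (LinearMap.funLeft ℤ ℤ ![i, j, k]))

/-- The value of `wedgeCoord i j k` on `stdWedge a b c`, a `3 × 3` determinant. -/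
def wedgeDet (i j k a b c : Fin 6) : ℤ :=
  let δ (p q : Fin 6) : ℤ := if p = q then 1 else 0
  δ i a * δ j b * δ k c - δ i a * δ k b * δ j c - δ j a * δ i b * δ k c
    + δ j a * δ k b * δ i c + δ k a * δ i b * δ j c - δ k a * δ j b * δ i c

theorem wedgeCoord_stdWedge (i j k a b c : Fin 6) :
    wedgeCoord i j k (stdWedge a b c) = wedgeDet i j k a b c := by
  rw [wedgeCoord, stdWedge, exteriorPower.alternatingMapLinearEquiv_apply_ιMulti,
    AlternatingMap.compLinearMap_apply]
  refine (Matrix.det_fin_three _).trans ?_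
  simp [LinearMap.funLeft_apply, Pi.single_apply, wedgeDet]

/-- The coordinate map inverse to `thetaLin`. -/
noncomputable def thetaInv : Wedge3 →ₗ[ℤ] FModule BinZ :=
  let c (p q : Fin 3 → Fin 6) (i j : Fin 3) : Wedge3 →ₗ[ℤ] ℤ :=
    wedgeCoord (p i) (q (j + 1)) (q (j + 2))
  let m (p q : Fin 3 → Fin 6) : Wedge3 →ₗ[ℤ] Herm3 BinZ :=
    (LinearMap.pi fun i => c p q i i).prod
      (LinearMap.pi fun i => (c p q (i + 1) (i + 2)).prod (c p q (i + 2) (i + 1)))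
  (wedgeCoord (eIdx 0) (eIdx 1) (eIdx 2)).prod
    ((wedgeCoord (fIdx 0) (fIdx 1) (fIdx 2)).prod ((m eIdx fIdx).prod (m fIdx eIdx)))

theorem thetaInv_stdWedge (a b c : Fin 6) :
    thetaInv (stdWedge a b c) =
      (wedgeDet 0 1 2 a b c, wedgeDet 3 4 5 a b c,
        (![wedgeDet 0 4 5 a b c, wedgeDet 1 5 3 a b c, wedgeDet 2 3 4 a b c],
          ![(wedgeDet 1 3 4 a b c, wedgeDet 2 5 3 a b c),
            (wedgeDet 2 4 5 a b c, wedgeDet 0 3 4 a b c),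
            (wedgeDet 0 5 3 a b c, wedgeDet 1 4 5 a b c)]),
        (![wedgeDet 3 1 2 a b c, wedgeDet 4 2 0 a b c, wedgeDet 5 0 1 a b c],
          ![(wedgeDet 4 0 1 a b c, wedgeDet 5 2 0 a b c),
            (wedgeDet 5 1 2 a b c, wedgeDet 3 0 1 a b c),
            (wedgeDet 3 2 0 a b c, wedgeDet 4 1 2 a b c)])) := by
  refine Prod.ext ?_ (Prod.ext ?_ (Prod.ext (Prod.ext ?_ ?_) (Prod.ext ?_ ?_)))
  · exact wedgeCoord_stdWedge 0 1 2 a b c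
  · exact wedgeCoord_stdWedge 3 4 5 a b c
  · funext i
    fin_cases i
    · exact wedgeCoord_stdWedge 0 4 5 a b c
    · exact wedgeCoord_stdWedge 1 5 3 a b c
    · exact wedgeCoord_stdWedge 2 3 4 a b c
  · funext i
    fin_cases i
    · exact Prod.ext (wedgeCoord_stdWedge 1 3 4 a b c) (wedgeCoord_stdWedge 2 5 3 a b c)
    · exact Prod.ext (wedgeCoord_stdWedge 2 4 5 a b c) (wedgeCoord_stdWedge 0 3 4 a b c)
    · exact Prod.ext (wedgeCoord_stdWedge 0 5 3 a b c) (wedgeCoord_stdWedge 1 4 5 a b c)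
  · funext i
    fin_cases i
    · exact wedgeCoord_stdWedge 3 1 2 a b c
    · exact wedgeCoord_stdWedge 4 2 0 a b c
    · exact wedgeCoord_stdWedge 5 0 1 a b c
  · funext i
    fin_cases i
    · exact Prod.ext (wedgeCoord_stdWedge 4 0 1 a b c) (wedgeCoord_stdWedge 5 2 0 a b c)
    · exact Prod.ext (wedgeCoord_stdWedge 5 1 2 a b c) (wedgeCoord_stdWedge 3 0 1 a b c)
    · exact Prod.ext (wedgeCoord_stdWedge 3 2 0 a b c) (wedgeCoord_stdWedge 4 1 2 a b c)

set_option synthInstance.maxSize 10000 in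
theorem thetaInv_thetaLin (x : FModule BinZ) : thetaInv (thetaLin x) = x := by
  have hE : ∀ i j : Fin 3, thetaInv (stdWedge (eIdx i) (fIdx (j + 1)) (fIdx (j + 2))) =
      (0, 0, ((fun k => if i = k ∧ j = k then 1 else 0),
        (fun k => (if i = k + 1 ∧ j = k + 2 then 1 else 0,
          if i = k + 2 ∧ j = k + 1 then 1 else 0))), 0) := by
    intro i j
    rw [thetaInv_stdWedge]
    revert i j
    decide
  have hF : ∀ i j : Fin 3, thetaInv (stdWedge (fIdx i) (eIdx (j + 1)) (eIdx (j + 2))) =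
      (0, 0, 0, ((fun k => if i = k ∧ j = k then 1 else 0),
        (fun k => (if i = k + 1 ∧ j = k + 2 then 1 else 0,
          if i = k + 2 ∧ j = k + 1 then 1 else 0)))) := by
    intro i j
    rw [thetaInv_stdWedge]
    revert i j
    decide
  have h0 : thetaInv (stdWedge (eIdx 0) (eIdx 1) (eIdx 2)) = (1, 0, 0, 0) := by
    rw [thetaInv_stdWedge]
    decide
  have h1 : thetaInv (stdWedge (fIdx 0) (fIdx 1) (fIdx 2)) = (0, 1, 0, 0) := by
    rw [thetaInv_stdWedge]
    decide
  obtain ⟨α, β, ⟨d, u⟩, ⟨d', u'⟩⟩ := x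
  simp only [thetaLin, LinearMap.coe_mk, AddHom.coe_mk, map_add, map_sum, map_smul, h0, h1, hE, hF]
  refine Prod.ext ?_ (Prod.ext ?_ (Prod.ext (Prod.ext ?_ ?_) (Prod.ext ?_ ?_)))
  · simp [Prod.fst_sum]
  · simp [Prod.fst_sum, Prod.snd_sum]
  · funext i
    fin_cases i <;> simp [Prod.fst_sum, Prod.snd_sum, Fin.sum_univ_three, Herm3.toMat]
  · funext i
    fin_cases i <;> refine Prod.ext ?_ ?_ <;>
      simp [Prod.fst_sum, Prod.snd_sum, Fin.sum_univ_three, Herm3.toMat]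
  · funext i
    fin_cases i <;> simp [Prod.fst_sum, Prod.snd_sum, Fin.sum_univ_three, Herm3.toMat]
  · funext i
    fin_cases i <;> refine Prod.ext ?_ ?_ <;>
      simp [Prod.fst_sum, Prod.snd_sum, Fin.sum_univ_three, Herm3.toMat]

theorem thetaLin_bijective : Function.Bijective thetaLin := by
  have hinj : Function.Injective thetaLin := Function.LeftInverse.injective thetaInv_thetaLin
  have hsurj : Function.Surjective thetaInv := fun x => ⟨thetaLin x, thetaInv_thetaLin x⟩
  have hrank : Module.finrank ℤ (FModule BinZ) = Module.finrank ℤ Wedge3 := by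
    rw [exteriorPower.finrank_eq]
    simp [Module.finrank_prod, Module.finrank_pi_fintype, Nat.choose]
  let e : FModule BinZ ≃ₗ[ℤ] Wedge3 := LinearEquiv.ofFinrankEq _ _ hrank
  have h1 : Function.Surjective (e.toLinearMap ∘ₗ thetaInv) := e.surjective.comp hsurj
  have h2 : Function.Injective (e.toLinearMap ∘ₗ thetaInv) :=
    IsNoetherian.injective_of_surjective_endomorphism _ h1
  have h3 : Function.Injective thetaInv := fun a b h => h2 (congrArg e h)
  exact ⟨hinj, fun w => ⟨thetaInv w, h3 (thetaInv_thetaLin _)⟩⟩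

/-- The isomorphism of the Freudenthal module of `Herm3 BinZ` with `⋀³ ℤ⁶`. -/
noncomputable def theta : FModule BinZ ≃ₗ[ℤ] Wedge3 :=
  LinearEquiv.ofBijective thetaLin thetaLin_bijective

/-- The quartic norm on `⋀³ ℤ⁶`. -/
noncomputable def Wedge3.quartic (w : Wedge3) : ℤ := (theta.symm w).quartic

/-- Projective elements of `⋀³ ℤ⁶`. -/
def Wedge3.IsProjective (w : Wedge3) : Prop := (theta.symm w).IsProjective

/-! ### The assertion on orbits -/

/-- An integer `n` is a fundamental discriminant if it is squarefree and `≡ 1 (mod 4)`, or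
`n = 4 k` with `k` squarefree and `≡ 2, 3 (mod 4)`; `n = 1` is included. -/
def IsFundamentalDiscriminant (n : ℤ) : Prop :=
  (Squarefree n ∧ n ≡ 1 [ZMOD 4]) ∨
    ∃ k : ℤ, n = 4 * k ∧ Squarefree k ∧ (k ≡ 2 [ZMOD 4] ∨ k ≡ 3 [ZMOD 4])

/-- The assertion on orbits for an integral representation `ρ` of `G` on `M`, a norm
`q : M → ℤ` and a set `P` of elements of `M` (the projective elements). -/
structure ProjectiveOrbitStructure {G M : Type} [Group G] [AddCommGroup M]
    (ρ : Representation ℤ G M) (q : M → ℤ) (P : M → Prop) : Prop where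
  /-- The norm is invariant. -/
  norm_invariant : ∀ g x, q (ρ g x) = q x
  /-- The norm takes only values congruent to `0` or `1` modulo `4`. -/
  norm_mod_four : ∀ x, q x ≡ 0 [ZMOD 4] ∨ q x ≡ 1 [ZMOD 4]
  /-- The group acts on the set of projective elements. -/
  projective_invariant : ∀ g x, P x → P (ρ g x)
  /-- Projective elements of each norm `n ≡ 0, 1 (mod 4)` exist. -/
  projective_nonempty : ∀ n : ℤ, n ≡ 0 [ZMOD 4] ∨ n ≡ 1 [ZMOD 4] → ∃ x, P x ∧ q x = n
  /-- The action on the projective elements of norm `n` is transitive. -/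
  projective_transitive : ∀ n : ℤ, n ≡ 0 [ZMOD 4] ∨ n ≡ 1 [ZMOD 4] →
    ∀ x y, P x → q x = n → P y → q y = n → ∃ g, ρ g x = y
  /-- If `n` is a fundamental discriminant, every element of norm `n` is projective. -/
  fundamental_projective : ∀ n : ℤ, IsFundamentalDiscriminant n → ∀ x, q x = n → P x
  /-- If `n` is a fundamental discriminant, the action on all elements of norm `n` is
  transitive. -/
  fundamental_transitive : ∀ n : ℤ, IsFundamentalDiscriminant n →
    ∀ x y, q x = n → q y = n → ∃ g, ρ g x = y

/-! The proof works with four explicit kinds of symmetry of the Freudenthal module: the swap, the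
cyclic rotation, the translations by multiples of a diagonal idempotent, and the shears `A ↦ g A g*`
with `g = 1 + u E₂₃`. They preserve `q'` and the symplectic form by identities valid in every
composition ring, so the three rings enter only through the axioms `SplitComposition`.

A Euclidean descent brings every nonzero element to the form `(α, β, diag(a, b, c), 0)` with `α`
dividing all entries (`ElemRel.exists_reduced`). The least positive `α` in the orbit must divide
`B`, hence `B` can be translated away; then `A` is diagonalised, with a least nonzero diagonal entry
as pivot (`HermRel.exists_diag`). The norm of the result is `α²β² + 4αabc`.

For a projective element the gcd conditions force `α = 1` and say that no prime divides `β` and two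
of `a, b, c`. A shift then makes two of the entries coprime, and null vectors of the composition
ring turn coprime `(a, b)` into `(1, ab)`. Doing this twice and reducing `β` modulo 2 gives `(1, ε,
diag(1, 1, m), 0)` with `ε ∈ {0, 1}` (`ElemRel.exists_normal_form`); the norm `n = ε² + 4m`
determines `ε` and `m`, whence transitivity. If `n` is a fundamental discriminant, a prime dividing
`α`, or dividing `β` and two of `a, b, c`, would contradict the shape of `n`, so every reduced
element of norm `n` is projective.

For `SL₆(ℤ)`, the generators correspond to matrices, and conversely every matrix comes from `FGroup
BinZ` because `SL₆(ℤ)` is generated by transvections. Since projectivity refers to orbits of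
`FGroup`, which is not assumed to come from `SL₆(ℤ)`, it must also be recognised on the reduced form
reached by elementary moves. This is done by an `FGroup`-invariant criterion: failure of primitivity
at `p` means that modulo `4p` the derivative of `q'` at `x` is a multiple of `2{x, ·}`
(`FModule.isDegenerateAt_diag`). -/

namespace Matrix.SpecialLinearGroup

/-! ### Generation of `SLₙ(ℤ)` by transvections. -/

variable {n : ℕ}

/-- A transvection as an element of the special linear group. -/
def elementary {i j : Fin n} (h : i ≠ j) (c : ℤ) : SpecialLinearGroup (Fin n) ℤ :=
  ⟨Matrix.transvection i j c, Matrix.det_transvection_of_ne i j h c⟩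

/-- Two matrices related by left multiplication with an element of the subgroup `K`. -/
def RowRel (K : Subgroup (SpecialLinearGroup (Fin n) ℤ)) (M N : Matrix (Fin n) (Fin n) ℤ) : Prop :=
  ∃ g ∈ K, (g : Matrix (Fin n) (Fin n) ℤ) * M = N

variable {K : Subgroup (SpecialLinearGroup (Fin n) ℤ)} {M N P : Matrix (Fin n) (Fin n) ℤ}

theorem RowRel.refl (M : Matrix (Fin n) (Fin n) ℤ) : RowRel K M M :=
  ⟨1, one_mem _, by simp⟩

theorem RowRel.trans (h : RowRel K M N) (h' : RowRel K N P) : RowRel K M P := by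
  obtain ⟨g, hg, rfl⟩ := h
  obtain ⟨k, hk, rfl⟩ := h'
  exact ⟨k * g, mul_mem hk hg, by rw [coe_mul, Matrix.mul_assoc]⟩

theorem RowRel.det_eq (h : RowRel K M N) : N.det = M.det := by
  obtain ⟨g, hg, rfl⟩ := h
  rw [Matrix.det_mul, g.det_coe, one_mul]

/-- The matrix obtained by adding `c` times row `j` to row `i`. -/
def addRow (M : Matrix (Fin n) (Fin n) ℤ) (i j : Fin n) (c : ℤ) : Matrix (Fin n) (Fin n) ℤ :=
  Matrix.of fun a b => if a = i then M a b + c * M j b else M a b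

theorem addRow_self (M : Matrix (Fin n) (Fin n) ℤ) (i j : Fin n) (c : ℤ) (b : Fin n) :
    addRow M i j c i b = M i b + c * M j b := if_pos rfl

theorem addRow_ne (M : Matrix (Fin n) (Fin n) ℤ) {i a : Fin n} (j : Fin n) (c : ℤ) (h : a ≠ i)
    (b : Fin n) : addRow M i j c a b = M a b := if_neg h

theorem RowRel.addRow (hK : ∀ (i j : Fin n) (h : i ≠ j) (c : ℤ), elementary h c ∈ K)
    {i j : Fin n} (h : i ≠ j) (c : ℤ) (M : Matrix (Fin n) (Fin n) ℤ) :
    RowRel K M (addRow M i j c) := by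
  refine ⟨_, hK i j h c, ?_⟩
  ext a b
  rw [elementary]
  by_cases ha : a = i
  · subst ha
    simp [transvection_mul_apply_same, addRow_self]
  · simp [transvection_mul_apply_of_ne, ha, addRow_ne]

/-- The first `k` columns are in echelon form. -/
def IsEchelon (k : ℕ) (M : Matrix (Fin n) (Fin n) ℤ) : Prop :=
  ∀ j : Fin n, (j : ℕ) < k → (∀ i, j < i → M i j = 0) ∧ ((∃ i, j < i) → 0 ≤ M j j)

theorem IsEchelon.addRow {k : Fin n} (hM : IsEchelon k M) {i j : Fin n} (hi : k ≤ i)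
    (hj : k ≤ j) (c : ℤ) : IsEchelon k (addRow M i j c) := by
  intro l hl
  have hli : l < i := lt_of_lt_of_le hl hi
  have hlj : l < j := lt_of_lt_of_le hl hj
  refine ⟨fun a ha => ?_, fun h => ?_⟩
  · by_cases hai : a = i
    · subst hai
      rw [addRow_self, (hM l hl).1 _ hli, (hM l hl).1 _ hlj, mul_zero, add_zero]
    · rw [addRow_ne _ _ _ hai, (hM l hl).1 a ha]
  · rw [addRow_ne _ _ _ hli.ne]
    exact (hM l hl).2 h

/-- Euclidean algorithm inside one column. Entries below the pivot carry weight two in the induction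
measure, so that moving a nonzero entry onto a vanishing pivot also lowers it. -/
theorem exists_clear_column (hK : ∀ (i j : Fin n) (h : i ≠ j) (c : ℤ), elementary h c ∈ K)
    (k : Fin n) (s : ℕ) : ∀ M : Matrix (Fin n) (Fin n) ℤ, IsEchelon k M →
      (M k k).natAbs + 2 * ∑ i ∈ Finset.Ioi k, (M i k).natAbs = s →
      ∃ N, RowRel K M N ∧ IsEchelon k N ∧ ∀ i, k < i → N i k = 0 := by
  induction s using Nat.strong_induction_on with
  | _ s ih =>
    intro M hM hs
    by_cases h0 : ∀ i, k < i → M i k = 0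
    · exact ⟨M, RowRel.refl M, hM, h0⟩
    push Not at h0
    obtain ⟨i, hki, hi0⟩ := h0
    have hsum : ∀ N : Matrix (Fin n) (Fin n) ℤ, (∀ a, a ≠ k → a ≠ i → N a k = M a k) →
        (N k k).natAbs + 2 * (N i k).natAbs < (M k k).natAbs + 2 * (M i k).natAbs →
        (N k k).natAbs + 2 * ∑ i ∈ Finset.Ioi k, (N i k).natAbs < s := by
      intro N hN hlt
      have hmem : i ∈ Finset.Ioi k := Finset.mem_Ioi.2 hki
      have heq : ∑ a ∈ (Finset.Ioi k).erase i, (N a k).natAbs =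
          ∑ a ∈ (Finset.Ioi k).erase i, (M a k).natAbs := by
        refine Finset.sum_congr rfl fun a ha => ?_
        rw [Finset.mem_erase, Finset.mem_Ioi] at ha
        rw [hN a ha.2.ne' ha.1]
      rw [← hs, ← Finset.add_sum_erase _ _ hmem, ← Finset.add_sum_erase _ _ hmem, heq]
      omega
    have step : ∀ N, RowRel K M N → IsEchelon k N → (∀ a, a ≠ k → a ≠ i → N a k = M a k) →
        (N k k).natAbs + 2 * (N i k).natAbs < (M k k).natAbs + 2 * (M i k).natAbs →
        ∃ N, RowRel K M N ∧ IsEchelon k N ∧ ∀ i, k < i → N i k = 0 := by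
      intro N h1 h2 h3 h4
      obtain ⟨P, h5, h6⟩ := ih _ (hsum N h3 h4) N h2 rfl
      exact ⟨P, h1.trans h5, h6⟩
    have e1 := fun c => RowRel.addRow hK hki.ne c M
    have f1 := fun c => hM.addRow le_rfl hki.le c
    have e2 := fun c => RowRel.addRow hK hki.ne' c M
    have f2 := fun c => hM.addRow hki.le le_rfl c
    have hmod : ∀ a b : ℤ, b ≠ 0 → (a + -(a / b) * b).natAbs < b.natAbs := by
      intro a b hb
      rw [show a + -(a / b) * b = a % b by rw [Int.emod_def]; ring]
      have h1 := Int.emod_nonneg a hb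
      have h2 := Int.emod_lt_abs a hb
      rw [Int.abs_eq_natAbs] at h2
      omega
    by_cases hd : M k k = 0
    · refine step _ ((e1 1).trans (RowRel.addRow hK hki.ne' (-1) _))
        ((f1 1).addRow hki.le le_rfl (-1)) (fun a h1 h2 => ?_) ?_
      · rw [addRow_ne _ _ _ h2, addRow_ne _ _ _ h1]
      · rw [addRow_ne _ _ _ hki.ne, addRow_self, addRow_self, addRow_ne _ _ _ hki.ne', addRow_self]
        simp [hd]
        omega
    by_cases hle : (M i k).natAbs ≤ (M k k).natAbs
    · refine step _ (e1 (-(M k k / M i k))) (f1 _) (fun a h1 h2 => by rw [addRow_ne _ _ _ h1]) ?_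
      rw [addRow_self, addRow_ne _ _ _ hki.ne']
      have := hmod (M k k) (M i k) hi0
      omega
    · refine step _ (e2 (-(M i k / M k k))) (f2 _) (fun a h1 h2 => by rw [addRow_ne _ _ _ h2]) ?_
      rw [addRow_self, addRow_ne _ _ _ hki.ne]
      have := hmod (M i k) (M k k) hd
      omega

theorem exists_isEchelon (hK : ∀ (i j : Fin n) (h : i ≠ j) (c : ℤ), elementary h c ∈ K)
    (M : Matrix (Fin n) (Fin n) ℤ) (k : ℕ) (hk : k ≤ n) : ∃ N, RowRel K M N ∧ IsEchelon k N := by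
  induction k with
  | zero => exact ⟨M, RowRel.refl M, fun j hj => absurd hj (Nat.not_lt_zero _)⟩
  | succ k ih =>
    obtain ⟨N, hMN, hN⟩ := ih (by omega)
    obtain ⟨P, hNP, hP, h0⟩ := exists_clear_column hK ⟨k, hk⟩ _ N hN rfl
    have hstep : ∀ Q : Matrix (Fin n) (Fin n) ℤ, IsEchelon k Q → (∀ i, ⟨k, hk⟩ < i → Q i ⟨k, hk⟩ = 0) →
        ((∃ i, (⟨k, hk⟩ : Fin n) < i) → 0 ≤ Q ⟨k, hk⟩ ⟨k, hk⟩) → IsEchelon (k + 1) Q := by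
      intro Q hQ h1 h2 j hj
      rcases Nat.lt_succ_iff_lt_or_eq.1 hj with hj | hj
      · exact hQ j hj
      · obtain rfl : j = ⟨k, hk⟩ := Fin.ext hj
        exact ⟨h1, h2⟩
    by_cases hpos : (∃ i, (⟨k, hk⟩ : Fin n) < i) → 0 ≤ P ⟨k, hk⟩ ⟨k, hk⟩
    · exact ⟨P, hMN.trans hNP, hstep P hP h0 hpos⟩
    push Not at hpos
    obtain ⟨⟨i, hi⟩, hneg⟩ := hpos
    -- A sign change using only transvections: the entries of the column in rows `k` and `i` run
    -- through `(p, 0)`, `(p, -p)`, `(-p, -p)`, `(-p, 0)`.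
    have r1 := RowRel.addRow hK hi.ne' (-1) P
    have r2 := r1.trans (RowRel.addRow hK hi.ne 2 _)
    have r3 := r2.trans (RowRel.addRow hK hi.ne' (-1) _)
    refine ⟨_, (hMN.trans hNP).trans r3, hstep _ (((IsEchelon.addRow (k := ⟨k, hk⟩) hP hi.le
      le_rfl _).addRow le_rfl hi.le _).addRow hi.le le_rfl _) (fun a ha => ?_) fun _ => ?_⟩
    · by_cases hai : a = i
      · subst hai
        rw [addRow_self, addRow_self, addRow_ne _ _ _ hi.ne', addRow_self, addRow_ne _ _ _ hi.ne,
          h0 _ hi]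
        ring
      · rw [addRow_ne _ _ _ hai, addRow_ne _ _ _ ha.ne', addRow_ne _ _ _ hai, h0 _ ha]
    · rw [addRow_ne _ _ _ hi.ne, addRow_self, addRow_ne _ _ _ hi.ne, addRow_self, h0 _ hi]
      linarith

/-- Row `k` vanishes in all columns before `k`, so subtracting its multiples clears column `k` and
leaves the earlier columns intact. The induction is on the number of nonzero entries still to be
cleared. -/
theorem exists_clear_above (hK : ∀ (i j : Fin n) (h : i ≠ j) (c : ℤ), elementary h c ∈ K)
    (k : Fin n) (s : ℕ) : ∀ M : Matrix (Fin n) (Fin n) ℤ, (∀ i, M i i = 1) →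
      (∀ i j, j < i → M i j = 0) → (∀ i j, i < j → j < k → M i j = 0) →
      ((Finset.univ.filter fun i => i < k ∧ M i k ≠ 0).card = s) →
      ∃ N, RowRel K M N ∧ (∀ i, N i i = 1) ∧ (∀ i j, j < i → N i j = 0) ∧
        ∀ i j, i < j → j ≤ k → N i j = 0 := by
  induction s using Nat.strong_induction_on with
  | _ s ih =>
    intro M h1 h2 h3 hs
    by_cases h0 : ∀ i, i < k → M i k = 0
    · exact ⟨M, RowRel.refl M, h1, h2, fun i j hij hj => hj.lt_or_eq.elim (h3 i j hij)
        fun h => h ▸ h0 i (h ▸ hij)⟩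
    push Not at h0
    obtain ⟨i, hik, hi⟩ := h0
    have hlt : (Finset.univ.filter fun a => a < k ∧ addRow M i k (-M i k) a k ≠ 0).card < s := by
      rw [← hs]
      apply Finset.card_lt_card
      rw [Finset.ssubset_iff_of_subset]
      · exact ⟨i, by simp [hik, hi], by simp [addRow_self, h1]⟩
      · intro a
        by_cases ha : a = i
        · subst ha; simp [addRow_self, h1]
        · simp [addRow_ne _ _ _ ha]
    have g1 : ∀ a, addRow M i k (-M i k) a a = 1 := fun a => by
      by_cases ha : a = i
      · subst ha; rw [addRow_self, h2 _ _ hik, h1, mul_zero, add_zero]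
      · rw [addRow_ne _ _ _ ha, h1]
    have g2 : ∀ a b, b < a → addRow M i k (-M i k) a b = 0 := fun a b hab => by
      by_cases ha : a = i
      · subst ha; rw [addRow_self, h2 _ _ hab, h2 _ _ (hab.trans hik), mul_zero, add_zero]
      · rw [addRow_ne _ _ _ ha, h2 _ _ hab]
    have g3 : ∀ a b, a < b → b < k → addRow M i k (-M i k) a b = 0 := fun a b hab hb => by
      by_cases ha : a = i
      · subst ha; rw [addRow_self, h3 _ _ hab hb, h2 _ _ hb, mul_zero, add_zero]
      · rw [addRow_ne _ _ _ ha, h3 _ _ hab hb]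
    obtain ⟨N, hN, h⟩ := ih _ hlt _ g1 g2 g3 rfl
    exact ⟨N, (RowRel.addRow hK hik.ne _ M).trans hN, h⟩

/-- The diagonal of the echelon form has product 1 and so consists of units. The sign condition
makes all of them 1 except possibly the last, which the determinant then settles. -/
theorem rowRel_one (hK : ∀ (i j : Fin n) (h : i ≠ j) (c : ℤ), elementary h c ∈ K)
    (M : Matrix (Fin n) (Fin n) ℤ) (hM : M.det = 1) : RowRel K M 1 := by
  obtain ⟨N, hMN, hN⟩ := exists_isEchelon hK M n le_rfl
  have hdet := hMN.det_eq.trans hM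
  have htri : ∀ i j, j < i → N i j = 0 := fun i j hij => (hN j j.2).1 i hij
  rw [Matrix.det_of_isUpperTriangular fun i j hij => htri i j hij] at hdet
  have hunit : ∀ i, N i i = 1 ∨ N i i = -1 := fun i =>
    Int.isUnit_iff.1 (isUnit_of_dvd_one (hdet ▸ Finset.dvd_prod_of_mem _ (Finset.mem_univ i)))
  have hpos : ∀ i j : Fin n, i < j → N i i = 1 := fun i j hij => by
    have := (hN i i.2).2 ⟨j, hij⟩
    rcases hunit i with h | h <;> omega
  have hdiag : ∀ i, N i i = 1 := by
    intro i
    by_cases hi : ∃ j, i < j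
    · exact hpos i hi.choose hi.choose_spec
    · push Not at hi
      rw [Finset.prod_eq_single i (fun j _ hj => hpos j i (lt_of_le_of_ne (hi j) hj))
        (by simp)] at hdet
      exact hdet
  have key : ∀ k ≤ n, ∃ P, RowRel K N P ∧ (∀ i, P i i = 1) ∧ (∀ i j, j < i → P i j = 0) ∧
      ∀ i j : Fin n, i < j → (j : ℕ) < k → P i j = 0 := by
    intro k
    induction k with
    | zero => exact fun _ => ⟨N, RowRel.refl N, hdiag, htri, fun i j _ h => absurd h (by omega)⟩
    | succ k ih =>
      intro hk
      obtain ⟨P, h1, h2, h3, h4⟩ := ih (by omega)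
      obtain ⟨Q, h5, h6, h7, h8⟩ := exists_clear_above hK ⟨k, hk⟩ _ P h2 h3 h4 rfl
      exact ⟨Q, h1.trans h5, h6, h7, fun i j hij hj => h8 i j hij (Nat.lt_succ_iff.1 hj)⟩
  obtain ⟨P, h1, h2, h3, h4⟩ := key n le_rfl
  have hP : P = 1 := by
    ext i j
    rcases lt_trichotomy i j with h | rfl | h
    · rw [h4 i j h j.2, Matrix.one_apply_ne h.ne]
    · rw [h2, Matrix.one_apply_eq]
    · rw [h3 i j h, Matrix.one_apply_ne h.ne']
  exact hP ▸ hMN.trans h1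

/-- A subgroup of `SLₙ(ℤ)` which contains all transvections is everything. -/
theorem eq_top_of_elementary_mem
    (hK : ∀ (i j : Fin n) (h : i ≠ j) (c : ℤ), elementary h c ∈ K) : K = ⊤ := by
  rw [eq_top_iff]
  intro M _
  obtain ⟨g, hg, h⟩ := rowRel_one hK M M.det_coe
  have : g * M = 1 := Subtype.ext h
  rw [← inv_eq_of_mul_eq_one_right this]
  exact inv_mem hg

theorem elementary_zsmul {i j : Fin n} (h : i ≠ j) (hK : elementary h 1 ∈ K) (c : ℤ) :
    elementary h c ∈ K := by
  have hmul : ∀ a b : ℤ, elementary h a * elementary h b = elementary h (a + b) := fun a b =>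
    Subtype.ext (Matrix.transvection_mul_transvection_same i j h a b)
  have h0 : elementary h 0 = 1 := Subtype.ext (Matrix.transvection_zero i j)
  let S : AddSubgroup ℤ :=
    { carrier := {c | elementary h c ∈ K}
      add_mem' := fun {a b} ha hb => by
        simpa [hmul] using mul_mem (S := Subgroup _) ha hb
      zero_mem' := by simp [h0]
      neg_mem' := fun {a} ha => by
        have : elementary h (-a) = (elementary h a)⁻¹ := by
          rw [eq_inv_iff_mul_eq_one, hmul, neg_add_cancel, h0]
        simpa [this] using ha }
  have : c • (1 : ℤ) ∈ S := S.zsmul_mem (x := 1) hK c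
  rwa [smul_eq_mul, mul_one] at this

/-- The commutator relation `[Eᵢⱼ, Eⱼₖ] = Eᵢₖ`. -/
theorem elementary_trans {i j k : Fin n} (hij : i ≠ j) (hjk : j ≠ k) (hik : i ≠ k)
    (h1 : elementary hij 1 ∈ K) (h2 : elementary hjk 1 ∈ K) : elementary hik 1 ∈ K := by
  have h : elementary hij 1 * elementary hjk 1 =
      elementary hik 1 * (elementary hjk 1 * elementary hij 1) := by
    apply Subtype.ext
    change Matrix.transvection i j 1 * Matrix.transvection j k 1 =
      Matrix.transvection i k 1 * (Matrix.transvection j k 1 * Matrix.transvection i j 1)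
    simp only [Matrix.transvection, mul_add, add_mul, one_mul, mul_one,
      Matrix.single_mul_single_same, Matrix.single_mul_single_of_ne, ne_eq,
      hjk.symm, hik.symm, not_false_eq_true, mul_zero]
    abel
  rw [← mul_inv_eq_iff_eq_mul] at h
  rw [← h]
  exact mul_mem (mul_mem h1 h2) (inv_mem (mul_mem h2 h1))

end Matrix.SpecialLinearGroup

-- Split composition rings: axioms and the three examples.

local infixl:70 " ⋆ " => CompOps.mul

/-- The bilinear form `tr (x * conj y)` of a composition ring. -/
def CompOps.pair {C : Type} [CompOps C] (x y : C) : ℤ := CompOps.tr (x ⋆ CompOps.conj y)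

/-- The axioms of a split composition ring over `ℤ`. The last two say that the bilinear form is
unimodular and that its lattice is spanned by null vectors. -/
class SplitComposition (C : Type) [CompOps C] [AddCommGroup C] : Prop where
  mul_add (x y z : C) : x ⋆ (y + z) = x ⋆ y + x ⋆ z
  add_mul (x y z : C) : (x + y) ⋆ z = x ⋆ z + y ⋆ z
  conj_add (x y : C) : CompOps.conj (x + y) = CompOps.conj x + CompOps.conj y
  conj_conj (x : C) : CompOps.conj (CompOps.conj x) = x
  conj_mul (x y : C) : CompOps.conj (x ⋆ y) = CompOps.conj y ⋆ CompOps.conj x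
  tr_add (x y : C) : CompOps.tr (x + y) = CompOps.tr x + CompOps.tr y
  tr_conj (x : C) : CompOps.tr (CompOps.conj x) = CompOps.tr x
  tr_mul_mul (x y z : C) : CompOps.tr (x ⋆ y ⋆ z) = CompOps.tr (y ⋆ z ⋆ x)
  norm_add (x y : C) : CompOps.norm (x + y) = CompOps.norm x + CompOps.norm y + CompOps.pair x y
  norm_zsmul (t : ℤ) (x : C) : CompOps.norm (t • x) = t ^ 2 * CompOps.norm x
  norm_mul (x y : C) : CompOps.norm (x ⋆ y) = CompOps.norm x * CompOps.norm y
  norm_conj (x : C) : CompOps.norm (CompOps.conj x) = CompOps.norm x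
  conj_mul_mul (x y : C) : CompOps.conj x ⋆ (x ⋆ y) = CompOps.norm x • y
  mul_mul_conj (x y : C) : y ⋆ x ⋆ CompOps.conj x = CompOps.norm x • y
  exists_hyperbolic : ∃ e f : C, CompOps.norm e = 0 ∧ CompOps.norm f = 0 ∧ CompOps.pair e f = 1
  dvd_of_null (d : ℤ) (x : C) (h : ∀ e f : C, CompOps.norm e = 0 → CompOps.pair e f = 1 →
    d ∣ CompOps.pair e x) : ∃ y, x = d • y

instance : SplitComposition BinZ where
  mul_add x y z := by ext <;> simp [CompOps.mul] <;> ring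
  add_mul x y z := by ext <;> simp [CompOps.mul] <;> ring
  conj_add x y := by ext <;> simp [CompOps.conj]
  conj_conj x := rfl
  conj_mul x y := by ext <;> simp [CompOps.mul, CompOps.conj] <;> ring
  tr_add x y := by simp [CompOps.tr]; ring
  tr_conj x := by simp [CompOps.tr, CompOps.conj]; ring
  tr_mul_mul x y z := by simp [CompOps.tr, CompOps.mul]; ring
  norm_add x y := by
    simp [CompOps.pair, CompOps.tr, CompOps.mul, CompOps.norm, CompOps.conj]; ring
  norm_zsmul t x := by simp [CompOps.norm]; ring
  norm_mul x y := by simp [CompOps.mul, CompOps.norm]; ring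
  norm_conj x := by simp [CompOps.conj, CompOps.norm]; ring
  conj_mul_mul x y := by
    ext <;> simp [CompOps.mul, CompOps.conj, CompOps.norm] <;> ring
  mul_mul_conj x y := by
    ext <;> simp [CompOps.mul, CompOps.conj, CompOps.norm] <;> ring
  exists_hyperbolic := ⟨(1, 0), (0, 1), by decide⟩
  dvd_of_null d x h := by
    obtain ⟨p, hp⟩ := h (1, 0) (0, 1) (by decide) (by decide)
    obtain ⟨q, hq⟩ := h (0, 1) (1, 0) (by decide) (by decide)
    simp [CompOps.pair, CompOps.tr, CompOps.mul, CompOps.conj] at hp hq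
    exact ⟨(q, p), by ext <;> simp [hp, hq]⟩

namespace QuatZ

@[simp] theorem adjugate_zero_zero (x : QuatZ) : x.adjugate 0 0 = x 1 1 := by
  simp [Matrix.adjugate_fin_two]

@[simp] theorem adjugate_zero_one (x : QuatZ) : x.adjugate 0 1 = -x 0 1 := by
  simp [Matrix.adjugate_fin_two]

@[simp] theorem adjugate_one_zero (x : QuatZ) : x.adjugate 1 0 = -x 1 0 := by
  simp [Matrix.adjugate_fin_two]

@[simp] theorem adjugate_one_one (x : QuatZ) : x.adjugate 1 1 = x 0 0 := by
  simp [Matrix.adjugate_fin_two]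

theorem pair_eq (x y : QuatZ) :
    CompOps.pair x y = x 0 0 * y 1 1 + x 1 1 * y 0 0 - x 0 1 * y 1 0 - x 1 0 * y 0 1 := by
  simp [CompOps.pair, CompOps.tr, CompOps.mul, CompOps.conj, Matrix.trace_fin_two,
    Matrix.mul_apply, Fin.sum_univ_two]
  ring

theorem norm_eq (x : QuatZ) : CompOps.norm x = x 0 0 * x 1 1 - x 0 1 * x 1 0 :=
  Matrix.det_fin_two x

end QuatZ

instance : SplitComposition QuatZ where
  mul_add := Matrix.mul_add
  add_mul := Matrix.add_mul
  conj_add x y := by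
    ext i j; fin_cases i <;> fin_cases j <;> simp [CompOps.conj] <;> ring
  conj_conj x := by
    ext i j; fin_cases i <;> fin_cases j <;> simp [CompOps.conj]
  conj_mul x y := Matrix.adjugate_mul_distrib x y
  tr_add := Matrix.trace_add
  tr_conj x := by simp [CompOps.conj, CompOps.tr, Matrix.trace_fin_two]; ring
  tr_mul_mul x y z := by
    simp only [CompOps.mul, CompOps.tr]
    rw [Matrix.mul_assoc, Matrix.trace_mul_comm]
  norm_add x y := by
    simp [CompOps.pair, CompOps.norm, CompOps.mul, CompOps.tr, CompOps.conj, Matrix.trace_fin_two,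
       Matrix.det_fin_two, Matrix.mul_apply, Fin.sum_univ_two]; ring
  norm_zsmul t x := by simp [QuatZ.norm_eq, -zsmul_eq_mul]; ring
  norm_mul := Matrix.det_mul
  norm_conj x := by simp [CompOps.conj, CompOps.norm, Matrix.det_fin_two]; ring
  conj_mul_mul x y := by
    simp only [CompOps.mul, CompOps.conj, CompOps.norm]
    rw [← Matrix.mul_assoc, Matrix.adjugate_mul, Matrix.smul_mul, Matrix.one_mul]
  mul_mul_conj x y := by
    simp only [CompOps.mul, CompOps.conj, CompOps.norm]
    rw [Matrix.mul_assoc, Matrix.mul_adjugate, Matrix.mul_smul, Matrix.mul_one]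
  exists_hyperbolic := ⟨!![1, 0; 0, 0], !![0, 0; 0, 1], by
    simp [QuatZ.pair_eq, QuatZ.norm_eq]⟩
  dvd_of_null d x h := by
    obtain ⟨p, hp⟩ := h !![1, 0; 0, 0] !![0, 0; 0, 1]
      (by simp [QuatZ.norm_eq])
      (by simp [QuatZ.pair_eq])
    obtain ⟨q, hq⟩ := h !![0, 0; 0, 1] !![1, 0; 0, 0]
      (by simp [QuatZ.norm_eq])
      (by simp [QuatZ.pair_eq])
    obtain ⟨r, hr⟩ := h !![0, 1; 0, 0] !![0, 0; -1, 0]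
      (by simp [QuatZ.norm_eq])
      (by simp [QuatZ.pair_eq])
    obtain ⟨s, hs⟩ := h !![0, 0; 1, 0] !![0, -1; 0, 0]
      (by simp [QuatZ.norm_eq])
      (by simp [QuatZ.pair_eq])
    simp [QuatZ.pair_eq] at hp hq hr hs
    refine ⟨!![q, -s; -r, p], ?_⟩
    ext i j; fin_cases i <;> fin_cases j <;> simp [-zsmul_eq_mul] <;> linarith

namespace OctZ

theorem pair_eq (x y : OctZ) :
    CompOps.pair x y = CompOps.pair x.1 y.1 + CompOps.pair x.2 y.2 := by
  simp [CompOps.pair, CompOps.mul, CompOps.conj, CompOps.tr, Matrix.trace_fin_two,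
    Matrix.mul_apply, Fin.sum_univ_two]
  ring

theorem norm_eq (x : OctZ) : CompOps.norm x = CompOps.norm x.1 + CompOps.norm x.2 := rfl

end OctZ

instance : SplitComposition OctZ where
  mul_add x y z := by
    simp only [CompOps.mul, Prod.fst_add, Prod.snd_add]
    refine Prod.ext ?_ ?_ <;> ext i j <;> fin_cases i <;> fin_cases j <;>
      simp [Matrix.mul_apply, Fin.sum_univ_two] <;> ring
  add_mul x y z := by
    simp only [CompOps.mul, Prod.fst_add, Prod.snd_add]
    refine Prod.ext ?_ ?_ <;> ext i j <;> fin_cases i <;> fin_cases j <;>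
      simp [Matrix.mul_apply, Fin.sum_univ_two] <;> ring
  conj_add x y := by
    simp only [CompOps.conj, Prod.fst_add, Prod.snd_add]
    refine Prod.ext ?_ ?_ <;> ext i j <;> fin_cases i <;> fin_cases j <;>
      simp  <;> ring
  conj_conj x := by
    simp only [CompOps.conj]
    refine Prod.ext ?_ ?_ <;> ext i j <;> fin_cases i <;> fin_cases j <;> simp
  conj_mul x y := by
    simp only [CompOps.mul, CompOps.conj]
    refine Prod.ext ?_ ?_ <;> ext i j <;> fin_cases i <;> fin_cases j <;>
      simp [Matrix.mul_apply, Fin.sum_univ_two] <;> ring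
  tr_add x y := Matrix.trace_add x.1 y.1
  tr_conj x := by simp [CompOps.conj, CompOps.tr, Matrix.trace_fin_two]; ring
  tr_mul_mul x y z := by
    simp [CompOps.mul, CompOps.tr, Matrix.mul_apply, Fin.sum_univ_two,
      Matrix.trace_fin_two]
    ring
  norm_add x y := by
    simp only [OctZ.norm_eq, OctZ.pair_eq, Prod.fst_add, Prod.snd_add, SplitComposition.norm_add]
    ring
  norm_zsmul t x := by
    simp only [OctZ.norm_eq, Prod.smul_fst, Prod.smul_snd, SplitComposition.norm_zsmul]
    ring
  norm_mul x y := by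
    simp [OctZ.norm_eq, QuatZ.norm_eq, CompOps.mul, Matrix.mul_apply, Fin.sum_univ_two]
    ring
  norm_conj x := by simp [CompOps.conj, OctZ.norm_eq, QuatZ.norm_eq]; ring
  conj_mul_mul x y := by
    rw [OctZ.norm_eq, QuatZ.norm_eq, QuatZ.norm_eq]
    simp only [CompOps.mul, CompOps.conj]
    refine Prod.ext ?_ ?_ <;> ext i j <;> fin_cases i <;> fin_cases j <;>
      simp [Matrix.mul_apply, Fin.sum_univ_two, -zsmul_eq_mul] <;> ring
  mul_mul_conj x y := by
    rw [OctZ.norm_eq, QuatZ.norm_eq, QuatZ.norm_eq]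
    simp only [CompOps.mul, CompOps.conj]
    refine Prod.ext ?_ ?_ <;> ext i j <;> fin_cases i <;> fin_cases j <;>
      simp [Matrix.mul_apply, Fin.sum_univ_two, -zsmul_eq_mul] <;> ring
  exists_hyperbolic := ⟨(!![1, 0; 0, 0], 0), (!![0, 0; 0, 1], 0), by
    simp [OctZ.pair_eq, QuatZ.pair_eq, OctZ.norm_eq, QuatZ.norm_eq]⟩
  dvd_of_null d x h := by
    obtain ⟨p, hp⟩ := SplitComposition.dvd_of_null d x.1 fun e f he hf => by
      have := h (e, 0) (f, 0) (by simp [OctZ.norm_eq, he, QuatZ.norm_eq])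
        (by simp [OctZ.pair_eq, hf, QuatZ.pair_eq])
      simpa [OctZ.pair_eq, QuatZ.pair_eq] using this
    obtain ⟨q, hq⟩ := SplitComposition.dvd_of_null d x.2 fun e f he hf => by
      have := h (0, e) (0, f) (by simp [OctZ.norm_eq, he, QuatZ.norm_eq])
        (by simp [OctZ.pair_eq, hf, QuatZ.pair_eq])
      simpa [OctZ.pair_eq, QuatZ.pair_eq] using this
    exact ⟨(p, q), Prod.ext hp hq⟩

/-! ### Linearity and polarised identities in composition rings. -/

namespace SplitComposition

open CompOps

variable {C : Type} [CompOps C] [AddCommGroup C] [SplitComposition C]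

theorem zsmul_mul (t : ℤ) (x y : C) : (t • x) ⋆ y = t • (x ⋆ y) :=
  map_zsmul (AddMonoidHom.mk' (· ⋆ y) fun a b => add_mul a b y) t x

theorem mul_zsmul (t : ℤ) (x y : C) : x ⋆ (t • y) = t • (x ⋆ y) :=
  map_zsmul (AddMonoidHom.mk' (x ⋆ ·) fun a b => mul_add x a b) t y

theorem neg_mul (x y : C) : (-x) ⋆ y = -(x ⋆ y) :=
  map_neg (AddMonoidHom.mk' (· ⋆ y) fun a b => add_mul a b y) x

theorem mul_neg (x y : C) : x ⋆ (-y) = -(x ⋆ y) :=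
  map_neg (AddMonoidHom.mk' (x ⋆ ·) fun a b => mul_add x a b) y

theorem sub_mul (x x' y : C) : (x - x') ⋆ y = x ⋆ y - x' ⋆ y :=
  map_sub (AddMonoidHom.mk' (· ⋆ y) fun a b => add_mul a b y) x x'

theorem mul_sub (x y y' : C) : x ⋆ (y - y') = x ⋆ y - x ⋆ y' :=
  map_sub (AddMonoidHom.mk' (x ⋆ ·) fun a b => mul_add x a b) y y'

theorem zero_mul (y : C) : (0 : C) ⋆ y = 0 :=
  map_zero (AddMonoidHom.mk' (· ⋆ y) fun a b => add_mul a b y)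

theorem mul_zero (x : C) : x ⋆ (0 : C) = 0 :=
  map_zero (AddMonoidHom.mk' (x ⋆ ·) fun a b => mul_add x a b)

theorem conj_zsmul (t : ℤ) (x : C) : conj (t • x) = t • conj x :=
  map_zsmul (AddMonoidHom.mk' (conj : C → C) conj_add) t x

theorem conj_neg (x : C) : conj (-x) = -conj x :=
  map_neg (AddMonoidHom.mk' (conj : C → C) conj_add) x

theorem conj_sub (x y : C) : conj (x - y) = conj x - conj y :=
  map_sub (AddMonoidHom.mk' (conj : C → C) conj_add) x y

theorem conj_zero : conj (0 : C) = 0 :=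
  map_zero (AddMonoidHom.mk' (conj : C → C) conj_add)

theorem tr_zsmul (t : ℤ) (x : C) : tr (t • x) = t * tr x := by
  simpa using map_zsmul (AddMonoidHom.mk' (tr : C → ℤ) tr_add) t x

theorem tr_neg (x : C) : tr (-x) = -tr x :=
  map_neg (AddMonoidHom.mk' (tr : C → ℤ) tr_add) x

theorem tr_sub (x y : C) : tr (x - y) = tr x - tr y :=
  map_sub (AddMonoidHom.mk' (tr : C → ℤ) tr_add) x y

theorem tr_zero : tr (0 : C) = 0 :=
  map_zero (AddMonoidHom.mk' (tr : C → ℤ) tr_add)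

theorem norm_zero : CompOps.norm (0 : C) = 0 := by
  simpa using norm_zsmul (0 : ℤ) (0 : C)

theorem norm_neg (x : C) : CompOps.norm (-x) = CompOps.norm x := by
  simpa using norm_zsmul (-1 : ℤ) x

theorem pair_comm (x y : C) : pair x y = pair y x := by
  have h := norm_add x y
  rw [add_comm x y, norm_add y x] at h
  linarith

theorem pair_add_left (x x' y : C) : pair (x + x') y = pair x y + pair x' y := by
  simp only [pair, add_mul, tr_add]

theorem pair_add_right (x y y' : C) : pair x (y + y') = pair x y + pair x y' := by
  simp only [pair, conj_add, mul_add, tr_add]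

theorem pair_sub_left (x x' y : C) : pair (x - x') y = pair x y - pair x' y := by
  simp only [pair, sub_mul, tr_sub]

theorem pair_sub_right (x y y' : C) : pair x (y - y') = pair x y - pair x y' := by
  simp only [pair, conj_sub, mul_sub, tr_sub]

theorem pair_neg_left (x y : C) : pair (-x) y = -pair x y := by
  simp only [pair, neg_mul, tr_neg]

theorem pair_neg_right (x y : C) : pair x (-y) = -pair x y := by
  simp only [pair, conj_neg, mul_neg, tr_neg]

theorem pair_zsmul_left (t : ℤ) (x y : C) : pair (t • x) y = t * pair x y := by
  simp only [pair, zsmul_mul, tr_zsmul]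

theorem pair_zsmul_right (t : ℤ) (x y : C) : pair x (t • y) = t * pair x y := by
  simp only [pair, conj_zsmul, mul_zsmul, tr_zsmul]

theorem pair_zero_left (y : C) : pair 0 y = 0 := by
  simp only [pair, zero_mul, tr_zero]

theorem pair_zero_right (x : C) : pair x 0 = 0 := by
  simp only [pair, conj_zero, mul_zero, tr_zero]

theorem norm_sub (x y : C) :
    CompOps.norm (x - y) = CompOps.norm x + CompOps.norm y - pair x y := by
  rw [sub_eq_add_neg, norm_add, norm_neg, pair_neg_right, sub_eq_add_neg]

theorem pair_self (x : C) : pair x x = 2 * CompOps.norm x := by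
  have h := norm_add x x
  rw [← two_zsmul, norm_zsmul] at h
  linarith

theorem pair_conj_conj (x y : C) : pair (conj x) (conj y) = pair x y := by
  have h := norm_add (conj x) (conj y)
  rw [← conj_add, norm_conj, norm_conj, norm_conj, norm_add] at h
  linarith

theorem tr_mul_comm (x y : C) : tr (x ⋆ y) = tr (y ⋆ x) := by
  have h := pair_conj_conj x (conj y)
  rw [pair, pair, conj_conj, conj_conj, ← conj_mul, tr_conj] at h
  exact h.symm

theorem tr_mul_assoc (x y z : C) : tr (x ⋆ (y ⋆ z)) = tr (x ⋆ y ⋆ z) := by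
  rw [tr_mul_comm, tr_mul_mul x y z]

/-- Polarisation of the multiplicativity of the norm. -/
theorem pair_mul_mul_right (x y z : C) : pair (x ⋆ z) (y ⋆ z) = CompOps.norm z * pair x y := by
  have h := norm_mul (x + y) z
  rw [add_mul, norm_add, norm_mul, norm_mul, norm_add] at h
  linarith

theorem pair_mul_mul_left (x y z : C) : pair (z ⋆ x) (z ⋆ y) = CompOps.norm z * pair x y := by
  have h := norm_mul z (x + y)
  rw [mul_add, norm_add, norm_mul, norm_mul, norm_add] at h
  linarith

theorem pair_conj_mul (x y z : C) : pair (conj (x ⋆ y)) z = tr (x ⋆ y ⋆ z) := by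
  rw [← pair_conj_conj, conj_conj, pair, conj_conj]

theorem pair_conj_mul' (x y z : C) : pair z (conj (x ⋆ y)) = tr (x ⋆ y ⋆ z) := by
  rw [pair_comm, pair_conj_mul]

theorem mul_conj_mul (x y : C) : x ⋆ (conj x ⋆ y) = CompOps.norm x • y := by
  have h := conj_mul_mul (conj x) y
  rwa [conj_conj, norm_conj] at h

theorem mul_conj_mul' (x y : C) : y ⋆ conj x ⋆ x = CompOps.norm x • y := by
  have h := mul_mul_conj (conj x) y
  rwa [conj_conj, norm_conj] at h

/-- Polarisation of `conj_mul_mul`; it stands in for associativity, which octonions lack. -/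
theorem conj_mul_mul_add (x u y : C) :
    conj x ⋆ (u ⋆ y) + conj u ⋆ (x ⋆ y) = pair u x • y := by
  have h := conj_mul_mul (x + u) y
  rw [conj_add, norm_add, add_mul, add_mul, mul_add, mul_add, conj_mul_mul, conj_mul_mul,
    add_smul, add_smul, pair_comm x u] at h
  rw [← sub_eq_zero] at h ⊢
  rw [← h]
  abel

theorem mul_mul_conj_add (x u y : C) :
    y ⋆ u ⋆ conj x + y ⋆ x ⋆ conj u = pair u x • y := by
  have h := mul_mul_conj (x + u) y
  rw [conj_add, norm_add, mul_add, mul_add, add_mul, add_mul, mul_mul_conj, mul_mul_conj,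
    add_smul, add_smul, pair_comm x u] at h
  rw [← sub_eq_zero] at h ⊢
  rw [← h]
  abel

end SplitComposition

/-! ### Shears of Hermitian matrices. -/

namespace Herm3

open CompOps SplitComposition

variable {C : Type} [CompOps C]

theorem tracePair_eq (A B : Herm3 C) : tracePair A B =
    A.1 0 * B.1 0 + A.1 1 * B.1 1 + A.1 2 * B.1 2 +
      (pair (A.2 0) (B.2 0) + pair (A.2 1) (B.2 1) + pair (A.2 2) (B.2 2)) := by
  simp only [tracePair, Fin.sum_univ_three, pair]

variable [AddCommGroup C]

/-- The action `A ↦ g A g*` of the elementary matrix `g = 1 + u E₂₃`. -/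
def shear (u : C) (A : Herm3 C) : Herm3 C :=
  (![A.1 0, A.1 1 + pair u (A.2 0) + CompOps.norm u * A.1 2, A.1 2],
   ![A.2 0 + A.1 2 • u, A.2 1, A.2 2 + conj (u ⋆ A.2 1)])

/-- The action contragredient to `Herm3.shear u`. -/
def coshear (u : C) (A : Herm3 C) : Herm3 C :=
  (![A.1 0, A.1 1, A.1 2 - pair u (A.2 0) + CompOps.norm u * A.1 1],
   ![A.2 0 - A.1 1 • u, A.2 1 - conj (A.2 2 ⋆ u), A.2 2])

/-- Cyclic shift of the indices. -/
def rotate {C : Type} (A : Herm3 C) : Herm3 C :=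
  (fun i => A.1 (i + 1), fun i => A.2 (i + 1))

theorem ext_fin {C : Type} {A B : Herm3 C} (h0 : A.1 0 = B.1 0) (h1 : A.1 1 = B.1 1)
    (h2 : A.1 2 = B.1 2) (k0 : A.2 0 = B.2 0) (k1 : A.2 1 = B.2 1) (k2 : A.2 2 = B.2 2) : A = B := by
  refine Prod.ext ?_ ?_ <;> funext i <;> fin_cases i <;> assumption

theorem sharp_eq (A : Herm3 C) : A.sharp =
    (![A.1 1 * A.1 2 - CompOps.norm (A.2 0), A.1 2 * A.1 0 - CompOps.norm (A.2 1),
      A.1 0 * A.1 1 - CompOps.norm (A.2 2)],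
     ![conj (A.2 1 ⋆ A.2 2) - A.1 0 • A.2 0, conj (A.2 2 ⋆ A.2 0) - A.1 1 • A.2 1,
      conj (A.2 0 ⋆ A.2 1) - A.1 2 • A.2 2]) := by
  apply ext_fin <;> rfl

variable [SplitComposition C]

theorem shear_add (u : C) (A B : Herm3 C) : shear u (A + B) = shear u A + shear u B := by
  apply ext_fin <;>
    simp [shear, pair_add_right, SplitComposition.mul_add, conj_add, add_smul] <;>
    first | ring | abel

theorem coshear_add (u : C) (A B : Herm3 C) : coshear u (A + B) = coshear u A + coshear u B := by
  apply ext_fin <;>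
    simp [coshear, pair_add_right, SplitComposition.add_mul, conj_add, add_smul] <;>
    first | ring | abel

theorem shear_shear (u v : C) (A : Herm3 C) : shear u (shear v A) = shear (u + v) A := by
  apply ext_fin <;>
    simp [shear, pair_add_right, pair_add_left, pair_zsmul_right, SplitComposition.add_mul,
      conj_add, smul_add, norm_add] <;>
    first | ring | abel

theorem coshear_coshear (u v : C) (A : Herm3 C) :
    coshear u (coshear v A) = coshear (u + v) A := by
  apply ext_fin <;>
    simp [coshear, pair_sub_right, pair_add_left, pair_zsmul_right, SplitComposition.mul_add,
      conj_add, smul_add, norm_add] <;>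
    first | ring | abel

theorem shear_zero (A : Herm3 C) : shear 0 A = A := by
  apply ext_fin <;>
    simp [shear, pair_zero_left, SplitComposition.norm_zero, SplitComposition.zero_mul, conj_zero]

theorem coshear_zero (A : Herm3 C) : coshear 0 A = A := by
  apply ext_fin <;>
    simp [coshear, pair_zero_left, SplitComposition.norm_zero, SplitComposition.mul_zero, conj_zero]

theorem tracePair_shear_coshear (u : C) (A B : Herm3 C) :
    tracePair (shear u A) (coshear u B) = tracePair A B := by
  simp only [tracePair_eq, shear, coshear, Matrix.cons_val, pair_add_left, pair_sub_right,
    pair_zsmul_left, pair_zsmul_right, pair_conj_mul, pair_conj_mul', pair_self,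
    pair_comm (A.2 0) u]
  rw [tr_mul_mul u (A.2 1) (B.2 2), tr_mul_mul (A.2 1) (B.2 2) u]
  ring

theorem cubicNorm_shear (u : C) (A : Herm3 C) : cubicNorm (shear u A) = cubicNorm A := by
  have h1 : tr (A.2 0 ⋆ A.2 1 ⋆ conj (u ⋆ A.2 1)) = CompOps.norm (A.2 1) * pair (A.2 0) u :=
    pair_mul_mul_right _ _ _
  have h2 : tr (u ⋆ A.2 1 ⋆ conj (u ⋆ A.2 1)) =
      2 * (CompOps.norm u * CompOps.norm (A.2 1)) := by
    rw [← SplitComposition.norm_mul]; exact pair_self _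
  simp only [cubicNorm, shear, Matrix.cons_val, norm_add, SplitComposition.add_mul,
    SplitComposition.mul_add, tr_add, SplitComposition.norm_zsmul, pair_zsmul_right, norm_conj,
    SplitComposition.norm_mul, pair_conj_mul', zsmul_mul, tr_zsmul, h1, h2, pair_comm (A.2 0) u]
  rw [tr_mul_mul u (A.2 1) (A.2 2)]
  ring

theorem cubicNorm_coshear (u : C) (A : Herm3 C) : cubicNorm (coshear u A) = cubicNorm A := by
  have h1 : tr (A.2 0 ⋆ conj (A.2 2 ⋆ u) ⋆ A.2 2) = CompOps.norm (A.2 2) * pair (A.2 0) u := by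
    rw [tr_mul_comm, tr_mul_assoc]
    exact pair_mul_mul_left _ _ _
  have h2 : tr (u ⋆ conj (A.2 2 ⋆ u) ⋆ A.2 2) =
      2 * (CompOps.norm (A.2 2) * CompOps.norm u) := by
    rw [tr_mul_comm, tr_mul_assoc, ← SplitComposition.norm_mul]
    exact pair_self _
  simp only [cubicNorm, coshear, Matrix.cons_val, SplitComposition.norm_sub,
    SplitComposition.sub_mul, SplitComposition.mul_sub, tr_sub, SplitComposition.norm_zsmul,
    pair_zsmul_right, norm_conj, SplitComposition.norm_mul, pair_conj_mul', zsmul_mul, tr_zsmul,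
    h1, h2, pair_comm (A.2 0) u]
  rw [tr_mul_mul (A.2 2) u (A.2 1)]
  ring

/-- The adjoint transforms contragrediently. Together with `tracePair_shear_coshear` this makes the
term `(A^#, B^#)` of the quartic form invariant under shears. -/
theorem sharp_shear (u : C) (A : Herm3 C) : (shear u A).sharp = coshear u A.sharp := by
  rw [sharp_eq, sharp_eq]
  apply ext_fin <;> simp only [shear, coshear, Matrix.cons_val]
  · simp only [norm_add, SplitComposition.norm_zsmul, pair_zsmul_right, pair_comm (A.2 0) u]
    ring
  · simp only [norm_add, norm_conj, SplitComposition.norm_mul, pair_conj_mul', pair_sub_right,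
      pair_zsmul_right]
    rw [tr_mul_mul u (A.2 1) (A.2 2)]
    ring
  · simp only [SplitComposition.mul_add, conj_add, SplitComposition.conj_mul, mul_conj_mul, conj_conj, smul_add,
      sub_smul, mul_smul, conj_zsmul]
    module
  · simp only [SplitComposition.mul_add, SplitComposition.add_mul, SplitComposition.sub_mul,
      conj_add, conj_sub, SplitComposition.conj_mul, conj_conj, smul_add, SplitComposition.mul_zsmul,
      zsmul_mul, conj_zsmul, add_smul, mul_smul, mul_conj_mul']
    -- The two mixed triple products are bracketed differently and cannot be reassociated; the
    -- polarised alternative law evaluates their sum.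
    have h := conj_mul_mul_add (A.2 0) u (A.2 1)
    rw [← sub_eq_zero] at h ⊢
    rw [← h]
    module
  · simp only [SplitComposition.add_mul, conj_add, smul_add, zsmul_mul, conj_zsmul]
    module

theorem sharp_coshear (u : C) (A : Herm3 C) : (coshear u A).sharp = shear u A.sharp := by
  rw [sharp_eq, sharp_eq]
  apply ext_fin <;> simp only [shear, coshear, Matrix.cons_val]
  · simp only [SplitComposition.norm_sub, SplitComposition.norm_zsmul, pair_zsmul_right,
      pair_comm (A.2 0) u]
    ring
  · simp only [SplitComposition.norm_sub, norm_conj, SplitComposition.norm_mul, pair_conj_mul',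
      pair_sub_right, pair_zsmul_right]
    rw [tr_mul_mul (A.2 2) u (A.2 1), tr_mul_mul u (A.2 1) (A.2 2)]
    ring
  · simp only [SplitComposition.sub_mul, conj_sub, SplitComposition.conj_mul, conj_conj, smul_sub,
      mul_conj_mul', sub_smul, mul_smul, conj_zsmul]
    module
  · simp only [SplitComposition.mul_sub, conj_sub, smul_sub, SplitComposition.mul_zsmul, conj_zsmul]
    module
  · simp only [SplitComposition.sub_mul,
      SplitComposition.mul_sub, conj_sub, SplitComposition.conj_mul, conj_conj, SplitComposition.mul_zsmul,
      zsmul_mul, conj_zsmul, add_smul, sub_smul, mul_smul, mul_mul_conj]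
    have h := mul_mul_conj_add (A.2 0) u (A.2 2)
    rw [← sub_eq_zero] at h ⊢
    rw [← neg_eq_zero.2 h]
    module

end Herm3

/-! ### The generators as transformations of the Freudenthal module. -/

namespace FModule

open CompOps SplitComposition Herm3

theorem ext_fin {C : Type} {x y : FModule C} (h1 : x.1 = y.1) (h2 : x.2.1 = y.2.1)
    (h3 : x.2.2.1 = y.2.2.1) (h4 : x.2.2.2 = y.2.2.2) : x = y :=
  Prod.ext h1 (Prod.ext h2 (Prod.ext h3 h4))

theorem quartic_eq {C : Type} [CompOps C] [AddCommGroup C] (x : FModule C) : x.quartic =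
    -4 * tracePair x.2.2.1.sharp x.2.2.2.sharp + 4 * x.1 * x.2.2.1.cubicNorm
      + 4 * x.2.1 * x.2.2.2.cubicNorm + (tracePair x.2.2.1 x.2.2.2 - x.1 * x.2.1) ^ 2 := rfl

theorem symp_eq {C : Type} [CompOps C] (x y : FModule C) : x.symp y =
    x.1 * y.2.1 - x.2.1 * y.1 + tracePair x.2.2.1 y.2.2.2 - tracePair x.2.2.2 y.2.2.1 := rfl

section AddCommGroup

variable {C : Type} [AddCommGroup C]

/-- The map `(α, β, A, B) ↦ (-β, α, -B, A)`. -/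
def swap (C : Type) [AddCommGroup C] : FModule C ≃ₗ[ℤ] FModule C :=
  AddEquiv.toIntLinearEquiv
    { toFun := fun x => (-x.2.1, x.1, -x.2.2.2, x.2.2.1)
      invFun := fun x => (x.2.1, -x.1, x.2.2.2, -x.2.2.1)
      left_inv := fun x => by simp
      right_inv := fun x => by simp
      map_add' := fun x y => by
        apply ext_fin <;> simp [add_comm] }

/-- Cyclic shift of the indices. -/
def rotate (C : Type) [AddCommGroup C] : FModule C ≃ₗ[ℤ] FModule C :=
  AddEquiv.toIntLinearEquiv
    { toFun := fun x => (x.1, x.2.1, x.2.2.1.rotate, x.2.2.2.rotate)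
      invFun := fun x => (x.1, x.2.1, x.2.2.1.rotate.rotate, x.2.2.2.rotate.rotate)
      left_inv := fun x => by
        apply ext_fin <;> first | rfl | (apply Herm3.ext_fin <;> rfl)
      right_inv := fun x => by
        apply ext_fin <;> first | rfl | (apply Herm3.ext_fin <;> rfl)
      map_add' := fun x y => rfl }

/-- The underlying function of `FModule.transl`. -/
def translFun (t : ℤ) (x : FModule C) : FModule C :=
  (x.1 + t * x.2.2.2.1 0, x.2.1,
    (![x.2.2.1.1 0 + t * x.2.1, x.2.2.1.1 1, x.2.2.1.1 2], x.2.2.1.2),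
    (![x.2.2.2.1 0, x.2.2.2.1 1 + t * x.2.2.1.1 2, x.2.2.2.1 2 + t * x.2.2.1.1 1],
      ![x.2.2.2.2 0 - t • x.2.2.1.2 0, x.2.2.2.2 1, x.2.2.2.2 2]))

theorem translFun_zero (x : FModule C) : translFun 0 x = x := by
  apply ext_fin
  · simp [translFun]
  · rfl
  · apply Herm3.ext_fin <;> simp [translFun]
  · apply Herm3.ext_fin <;> simp [translFun]

theorem translFun_translFun (s t : ℤ) (x : FModule C) :
    translFun s (translFun t x) = translFun (s + t) x := by
  apply ext_fin
  · simp [translFun]; ring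
  · rfl
  · apply Herm3.ext_fin <;> simp [translFun]; ring
  · apply Herm3.ext_fin <;> simp [translFun] <;> first | ring1 | module

/-- The translation by `t` times the first diagonal idempotent. -/
def transl (C : Type) [AddCommGroup C] (t : ℤ) : FModule C ≃ₗ[ℤ] FModule C :=
  AddEquiv.toIntLinearEquiv
    { toFun := translFun t
      invFun := translFun (-t)
      left_inv := fun x => by
        rw [translFun_translFun]; simp [translFun_zero]
      right_inv := fun x => by
        rw [translFun_translFun]; simp [translFun_zero]
      map_add' := fun x y => by
        apply ext_fin
        · simp [translFun]; ring
        · rfl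
        · apply Herm3.ext_fin <;> simp [translFun]; ring
        · apply Herm3.ext_fin <;> simp [translFun] <;> first | ring1 | module }

theorem swap_apply (x : FModule C) : swap C x = (-x.2.1, x.1, -x.2.2.2, x.2.2.1) := rfl

theorem rotate_apply (x : FModule C) :
    rotate C x = (x.1, x.2.1, x.2.2.1.rotate, x.2.2.2.rotate) := rfl

theorem transl_apply (t : ℤ) (x : FModule C) : transl C t x =
    (x.1 + t * x.2.2.2.1 0, x.2.1,
      (![x.2.2.1.1 0 + t * x.2.1, x.2.2.1.1 1, x.2.2.1.1 2], x.2.2.1.2),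
      (![x.2.2.2.1 0, x.2.2.2.1 1 + t * x.2.2.1.1 2, x.2.2.2.1 2 + t * x.2.2.1.1 1],
        ![x.2.2.2.2 0 - t • x.2.2.1.2 0, x.2.2.2.2 1, x.2.2.2.2 2])) := rfl

end AddCommGroup

theorem tracePair_rotate {C : Type} [CompOps C] (A B : Herm3 C) : tracePair A.rotate B.rotate = tracePair A B := by
  simp only [tracePair_eq, Herm3.rotate, Fin.reduceAdd, Fin.isValue, zero_add]
  ring

theorem sharp_rotate {C : Type} [CompOps C] [AddCommGroup C] (A : Herm3 C) : A.rotate.sharp = A.sharp.rotate := by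
  apply Herm3.ext_fin <;> rfl

variable {C : Type} [CompOps C] [AddCommGroup C] [SplitComposition C]

/-- The shear by `1 + u E₂₃` as a transformation of the Freudenthal module. -/
def shear (u : C) : FModule C ≃ₗ[ℤ] FModule C :=
  AddEquiv.toIntLinearEquiv
    { toFun := fun x => (x.1, x.2.1, x.2.2.1.shear u, x.2.2.2.coshear u)
      invFun := fun x => (x.1, x.2.1, x.2.2.1.shear (-u), x.2.2.2.coshear (-u))
      left_inv := fun x => by
        simp [shear_shear, coshear_coshear, shear_zero, coshear_zero]
      right_inv := fun x => by
        simp [shear_shear, coshear_coshear, shear_zero, coshear_zero]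
      map_add' := fun x y => by
        simp [shear_add, coshear_add] }

theorem shear_apply (u : C) (x : FModule C) :
    shear u x = (x.1, x.2.1, x.2.2.1.shear u, x.2.2.2.coshear u) := rfl

theorem tracePair_comm (A B : Herm3 C) : tracePair A B = tracePair B A := by
  simp only [tracePair_eq, pair_comm (B.2 _) (A.2 _)]
  ring

theorem tracePair_neg_left (A B : Herm3 C) : tracePair (-A) B = -tracePair A B := by
  simp only [tracePair_eq, Prod.fst_neg, Prod.snd_neg, Pi.neg_apply, pair_neg_left]
  ring

theorem sharp_neg (A : Herm3 C) : (-A).sharp = A.sharp := by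
  rw [sharp_eq, sharp_eq]
  simp only [Prod.fst_neg, Prod.snd_neg, Pi.neg_apply, SplitComposition.norm_neg,
    SplitComposition.neg_mul, SplitComposition.mul_neg, neg_neg, neg_smul, smul_neg, _root_.neg_mul,
    _root_.mul_neg]

theorem cubicNorm_neg (A : Herm3 C) : (-A).cubicNorm = -A.cubicNorm := by
  simp only [cubicNorm, Prod.fst_neg, Prod.snd_neg, Pi.neg_apply, SplitComposition.norm_neg,
    SplitComposition.neg_mul, SplitComposition.mul_neg, neg_neg, tr_neg]
  ring

theorem cubicNorm_rotate (A : Herm3 C) : A.rotate.cubicNorm = A.cubicNorm := by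
  simp only [cubicNorm, Herm3.rotate, Fin.reduceAdd, Fin.isValue, zero_add]
  rw [tr_mul_mul (A.2 0)]
  ring

/-- Everything is expressed by integer-valued norms, pairings and traces, so that the invariance in
`transl_mem` becomes an identity of integer polynomials. -/
theorem tracePair_sharp (A B : Herm3 C) : tracePair A.sharp B.sharp =
    (A.1 1 * A.1 2 - CompOps.norm (A.2 0)) * (B.1 1 * B.1 2 - CompOps.norm (B.2 0))
    + (A.1 2 * A.1 0 - CompOps.norm (A.2 1)) * (B.1 2 * B.1 0 - CompOps.norm (B.2 1))
    + (A.1 0 * A.1 1 - CompOps.norm (A.2 2)) * (B.1 0 * B.1 1 - CompOps.norm (B.2 2))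
    + (pair (A.2 1 ⋆ A.2 2) (B.2 1 ⋆ B.2 2) + pair (A.2 2 ⋆ A.2 0) (B.2 2 ⋆ B.2 0)
      + pair (A.2 0 ⋆ A.2 1) (B.2 0 ⋆ B.2 1))
    - (A.1 0 * tr (A.2 0 ⋆ B.2 1 ⋆ B.2 2) + A.1 1 * tr (B.2 0 ⋆ A.2 1 ⋆ B.2 2)
      + A.1 2 * tr (B.2 0 ⋆ B.2 1 ⋆ A.2 2))
    - (B.1 0 * tr (B.2 0 ⋆ A.2 1 ⋆ A.2 2) + B.1 1 * tr (A.2 0 ⋆ B.2 1 ⋆ A.2 2)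
      + B.1 2 * tr (A.2 0 ⋆ A.2 1 ⋆ B.2 2))
    + (A.1 0 * B.1 0 * pair (A.2 0) (B.2 0) + A.1 1 * B.1 1 * pair (A.2 1) (B.2 1)
      + A.1 2 * B.1 2 * pair (A.2 2) (B.2 2)) := by
  rw [tracePair_eq, sharp_eq, sharp_eq]
  simp only [Matrix.cons_val, pair_sub_left, pair_sub_right, pair_zsmul_left, pair_zsmul_right,
    pair_conj_conj]
  simp only [pair_conj_mul, pair_conj_mul']
  rw [tr_mul_mul (A.2 0) (B.2 1) (B.2 2), tr_mul_mul (B.2 0) (A.2 1) (A.2 2),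
    tr_mul_mul (B.2 0) (A.2 1) (B.2 2), tr_mul_mul (A.2 0) (B.2 1) (A.2 2),
    tr_mul_mul (A.2 1) (B.2 2) (B.2 0), tr_mul_mul (B.2 1) (A.2 2) (A.2 0)]
  ring

theorem swap_mem : swap C ∈ FGroup C := by
  refine ⟨fun x => ?_, fun x y => ?_⟩
  · simp only [quartic_eq, swap_apply, sharp_neg, cubicNorm_neg, tracePair_neg_left,
      tracePair_comm x.2.2.2, tracePair_comm x.2.2.2.sharp]
    ring
  · simp only [symp_eq, swap_apply, tracePair_neg_left, tracePair_comm _ (-y.2.2.2),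
      tracePair_comm y.2.2.2]
    ring

theorem rotate_mem : rotate C ∈ FGroup C := by
  refine ⟨fun x => ?_, fun x y => ?_⟩
  · simp only [quartic_eq, rotate_apply, sharp_rotate, cubicNorm_rotate, tracePair_rotate]
  · simp only [symp_eq, rotate_apply, tracePair_rotate]

theorem shear_mem (u : C) : shear u ∈ FGroup C := by
  refine ⟨fun x => ?_, fun x y => ?_⟩
  · simp only [quartic_eq, shear_apply, sharp_shear, sharp_coshear, cubicNorm_shear,
      cubicNorm_coshear, tracePair_shear_coshear]
    rw [tracePair_comm (Herm3.coshear _ _), tracePair_shear_coshear, tracePair_comm]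
  · simp only [symp_eq, shear_apply, tracePair_shear_coshear]
    rw [tracePair_comm (Herm3.coshear _ _), tracePair_shear_coshear, tracePair_comm x.2.2.2]

/-- A diagonal idempotent has zero adjoint and zero cubic norm, so the quadratic and cubic terms of
a general translation are absent. Products in which the shifted entry meets itself are evaluated by
the polarised multiplicativity of the norm. -/
theorem transl_mem (t : ℤ) : transl C t ∈ FGroup C := by
  refine ⟨fun x => ?_, fun x y => ?_⟩
  · obtain ⟨α, β, A, B⟩ := x
    simp only [quartic_eq, transl_apply, tracePair_sharp]
    simp only [cubicNorm, tracePair_eq,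
      Matrix.cons_val, SplitComposition.norm_sub, SplitComposition.norm_zsmul,
      pair_sub_right, pair_zsmul_right, SplitComposition.sub_mul,
      SplitComposition.mul_sub, zsmul_mul, SplitComposition.mul_zsmul, tr_sub, tr_zsmul,
      pair_mul_mul_right, pair_mul_mul_left, pair_self, pair_comm (B.2 0) (A.2 0)]
    ring
  · obtain ⟨α, β, A, B⟩ := x
    obtain ⟨γ, δ, A', B'⟩ := y
    simp only [symp_eq, transl_apply, tracePair_eq, Matrix.cons_val, pair_sub_left,
      pair_sub_right, pair_zsmul_left, pair_zsmul_right]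
    ring

end FModule

/-! ### The elementary group and its orbits. -/

section

open CompOps SplitComposition

/-- The group of transformations of the Freudenthal module generated by the swap, the rotation,
the translations by diagonal idempotents and the shears. -/
def elementaryGroup (C : Type) [CompOps C] [AddCommGroup C] [SplitComposition C] :
    Subgroup (FModule C ≃ₗ[ℤ] FModule C) :=
  Subgroup.closure ({FModule.swap C, FModule.rotate C} ∪
    (Set.range (FModule.transl C) ∪ Set.range FModule.shear))

namespace elementaryGroup

variable (C : Type) [CompOps C] [AddCommGroup C] [SplitComposition C]

theorem le_iff (K : Subgroup (FModule C ≃ₗ[ℤ] FModule C)) : elementaryGroup C ≤ K ↔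
    FModule.swap C ∈ K ∧ FModule.rotate C ∈ K ∧ (∀ t, FModule.transl C t ∈ K) ∧
      ∀ u, FModule.shear u ∈ K := by
  simp [elementaryGroup, Subgroup.closure_le, Set.insert_subset_iff, Set.range_subset_iff,
    and_assoc]

theorem le_FGroup : elementaryGroup C ≤ FGroup C :=
  (le_iff C _).2 ⟨FModule.swap_mem, FModule.rotate_mem, FModule.transl_mem, FModule.shear_mem⟩

end elementaryGroup

/-- Two elements of the Freudenthal module are related if they lie in the same orbit of the
elementary group. -/
def ElemRel {C : Type} [CompOps C] [AddCommGroup C] [SplitComposition C] (x y : FModule C) : Prop :=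
  ∃ g ∈ elementaryGroup C, g x = y

namespace ElemRel

variable {C : Type} [CompOps C] [AddCommGroup C] [SplitComposition C] {x y z : FModule C}

theorem refl (x : FModule C) : ElemRel x x := ⟨1, one_mem _, rfl⟩

theorem symm (h : ElemRel x y) : ElemRel y x := by
  obtain ⟨g, hg, rfl⟩ := h
  exact ⟨g⁻¹, inv_mem hg, g.symm_apply_apply x⟩

theorem trans (h : ElemRel x y) (h' : ElemRel y z) : ElemRel x z := by
  obtain ⟨g, hg, rfl⟩ := h
  obtain ⟨k, hk, rfl⟩ := h'
  exact ⟨k * g, mul_mem hk hg, rfl⟩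

theorem quartic_eq (h : ElemRel x y) : y.quartic = x.quartic := by
  obtain ⟨g, hg, rfl⟩ := h
  exact (elementaryGroup.le_FGroup C hg).1 x

theorem swap (x : FModule C) : ElemRel x (-x.2.1, x.1, -x.2.2.2, x.2.2.1) :=
  ⟨_, ((elementaryGroup.le_iff C _).1 le_rfl).1, rfl⟩

theorem rotate (x : FModule C) : ElemRel x (x.1, x.2.1, x.2.2.1.rotate, x.2.2.2.rotate) :=
  ⟨_, ((elementaryGroup.le_iff C _).1 le_rfl).2.1, rfl⟩

theorem transl (t : ℤ) (x : FModule C) : ElemRel x (FModule.transl C t x) :=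
  ⟨_, ((elementaryGroup.le_iff C _).1 le_rfl).2.2.1 t, rfl⟩

theorem shear (u : C) (x : FModule C) :
    ElemRel x (x.1, x.2.1, x.2.2.1.shear u, x.2.2.2.coshear u) :=
  ⟨_, ((elementaryGroup.le_iff C _).1 le_rfl).2.2.2 u, rfl⟩

theorem of_swap (h : ElemRel (-x.2.1, x.1, -x.2.2.2, x.2.2.1) (-y.2.1, y.1, -y.2.2.2, y.2.2.1)) :
    ElemRel x y :=
  ((swap x).trans h).trans (swap y).symm

/-- The swap squares to `-1`. -/
theorem neg (x : FModule C) : ElemRel x (-x) :=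
  (swap x).trans (swap _)

/-- The conjugate of a shear by the swap, which exchanges the roles of `A` and `B`. -/
theorem coshear (u : C) (x : FModule C) :
    ElemRel x (x.1, x.2.1, x.2.2.1.coshear u, x.2.2.2.shear u) := by
  apply of_swap
  have h := shear u (-x.2.1, x.1, -x.2.2.2, x.2.2.1)
  rwa [show Herm3.shear u (-x.2.2.2) = -Herm3.shear u x.2.2.2 from
    map_neg (AddMonoidHom.mk' (Herm3.shear u) (Herm3.shear_add u)) _] at h

/-- The translation opposite to `FModule.transl`. -/
theorem cotransl (t : ℤ) (x : FModule C) : ElemRel x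
    (x.1, x.2.1 + t * x.2.2.1.1 0,
      (![x.2.2.1.1 0, x.2.2.1.1 1 + t * x.2.2.2.1 2, x.2.2.1.1 2 + t * x.2.2.2.1 1],
        ![x.2.2.1.2 0 - t • x.2.2.2.2 0, x.2.2.1.2 1, x.2.2.1.2 2]),
      (![x.2.2.2.1 0 + t * x.1, x.2.2.2.1 1, x.2.2.2.1 2], x.2.2.2.2)) := by
  apply of_swap
  have h := transl (-t) (-x.2.1, x.1, -x.2.2.2, x.2.2.1)
  rw [FModule.transl_apply] at h
  convert h using 1
  apply FModule.ext_fin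
  · simp; ring
  · simp
  · apply Herm3.ext_fin <;> simp; ring
  · apply Herm3.ext_fin <;> simp

end ElemRel

/-! ### Diagonalisation of Hermitian matrices by descent. -/

namespace Herm3

variable {C : Type} [CompOps C] [AddCommGroup C] [SplitComposition C]

/-- Rotation carries divisibility to all diagonal entries. A shear adds `⟨u, x⟩ + n(u) c` to a
diagonal entry, so `d ∣ ⟨u, x⟩` for all `u`, and unimodularity gives `d ∣ x`. The case `d = 0`
serves as a vanishing criterion. -/
theorem exists_smul_eq_of_closed (R : Set (Herm3 C)) (d : ℤ) (hrot : ∀ A ∈ R, A.rotate ∈ R)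
    (hshear : ∀ A ∈ R, ∀ u, A.shear u ∈ R) (hd : ∀ A ∈ R, d ∣ A.1 0) (A : Herm3 C) (hA : A ∈ R) :
    ∃ B, A = d • B := by
  have h1 : ∀ A ∈ R, d ∣ A.1 1 := fun A hA => hd _ (hrot _ hA)
  have h2 : ∀ A ∈ R, d ∣ A.1 2 := fun A hA => h1 _ (hrot _ hA)
  have k0 : ∀ A ∈ R, ∃ y, A.2 0 = d • y := fun A hA =>
    dvd_of_null d _ fun u _ _ _ => by
      have := h1 _ (hshear _ hA u)
      simp only [shear, Matrix.cons_val] at this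
      rwa [add_assoc, dvd_add_right (h1 A hA), dvd_add_left ((h2 A hA).mul_left _)] at this
  have k1 : ∀ A ∈ R, ∃ y, A.2 1 = d • y := fun A hA => k0 _ (hrot _ hA)
  have k2 : ∀ A ∈ R, ∃ y, A.2 2 = d • y := fun A hA => k1 _ (hrot _ hA)
  obtain ⟨a0, ha0⟩ := hd A hA
  obtain ⟨a1, ha1⟩ := h1 A hA
  obtain ⟨a2, ha2⟩ := h2 A hA
  obtain ⟨x0, hx0⟩ := k0 A hA
  obtain ⟨x1, hx1⟩ := k1 A hA
  obtain ⟨x2, hx2⟩ := k2 A hA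
  exact ⟨(![a0, a1, a2], ![x0, x1, x2]), by apply ext_fin <;> simpa⟩

end Herm3

namespace SplitComposition

variable {C : Type} [CompOps C] [AddCommGroup C] [SplitComposition C]

/-- If no nonzero value of `b + ⟨u, x⟩ + n(u) c` is smaller than `c`, then `c` divides `x`. -/
theorem exists_smul_eq_of_min {b c : ℤ} {x : C} (hc : c ≠ 0)
    (h : ∀ u, b + pair u x + CompOps.norm u * c ≠ 0 →
      |c| ≤ |b + pair u x + CompOps.norm u * c|) : ∃ u, x = c • u := by
  apply dvd_of_null
  intro e f he hef
  by_contra hdvd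
  set r := pair e x % c with hr
  have hr0 : 0 < r := lt_of_le_of_ne (Int.emod_nonneg _ hc) fun h0 =>
    hdvd (Int.dvd_of_emod_eq_zero h0.symm)
  have hrc : r < |c| := Int.emod_lt_abs _ hc
  set t := -(pair e x / c) with ht
  have hrt : pair e x + t * c = r := by
    rw [hr, Int.emod_def, ht]; ring
  -- The choice `u = s e + t f` makes the value linear in `s`: `e` is null and `⟨e, f⟩ = 1`, so the
  -- coefficient of `s` is `⟨e, x⟩ + t c = r`.
  have key : ∀ s : ℤ, b + pair (s • e + t • f) x + CompOps.norm (s • e + t • f) * c =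
      b + t * pair f x + t ^ 2 * CompOps.norm f * c + s * r := fun s => by
    rw [← hrt]
    simp only [pair_add_left, pair_zsmul_left, pair_zsmul_right, norm_add,
      SplitComposition.norm_zsmul, he, hef]
    ring
  set b' := b + t * pair f x + t ^ 2 * CompOps.norm f * c
  -- The values `b' + s r` contain the remainder of `b'` modulo `r`. If it is nonzero it is a value
  -- smaller than `|c|`; if it is zero, then `r` itself is such a value.
  have h1 : b' % r = 0 := by
    by_contra h0
    have := h (-(b' / r) • e + t • f)
    rw [key, show b' + -(b' / r) * r = b' % r by rw [Int.emod_def]; ring,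
      abs_of_nonneg (Int.emod_nonneg _ hr0.ne')] at this
    have := this h0
    have := Int.emod_lt_of_pos b' hr0
    omega
  have := h ((1 - b' / r) • e + t • f)
  rw [key, show b' + (1 - b' / r) * r = r + b' % r by rw [Int.emod_def]; ring, h1, add_zero,
    abs_of_pos hr0] at this
  have := this hr0.ne'
  omega

/-- Diagonalization of Hermitian `2 × 2` matrices, with a pivot of minimal absolute value. -/
theorem exists_offdiag_zero_of_min (P : ℤ → C → ℤ → Prop)
    (h1 : ∀ a z b u, P a z b → P (a + pair u z + CompOps.norm u * b) (z + b • u) b)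
    {a b : ℤ} {z : C} (hb : b ≠ 0) (hP : P a z b)
    (hmin : ∀ a' z', P a' z' b → a' ≠ 0 → |b| ≤ |a'|) : ∃ a', P a' 0 b := by
  obtain ⟨u, rfl⟩ := exists_smul_eq_of_min hb fun u hu => hmin _ _ (h1 a z b u hP) hu
  exact ⟨_, by simpa using h1 _ _ _ (-u) hP⟩

/-- The predicate `P` stands for membership in an orbit of `2 × 2` Hermitian matrices, so that the
result applies to a block of a `3 × 3` matrix. The pivot is a least nonzero diagonal entry of the
orbit; if there is none, every `⟨u, z⟩` vanishes and so does `z`. -/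
theorem exists_offdiag_zero (P : ℤ → C → ℤ → Prop)
    (h1 : ∀ a z b u, P a z b → P (a + pair u z + CompOps.norm u * b) (z + b • u) b)
    (h2 : ∀ a z b u, P a z b → P a (z + a • u) (b + pair u z + CompOps.norm u * a))
    {a b : ℤ} {z : C} (hP : P a z b) : ∃ a' b', P a' 0 b' := by
  classical
  by_cases hex : ∃ n : ℕ, n ≠ 0 ∧ ∃ a z b, P a z b ∧ (a.natAbs = n ∨ b.natAbs = n)
  · obtain ⟨hn, a', z', b', hP', hab⟩ := Nat.find_spec hex
    have hmin : ∀ m : ℕ, m ≠ 0 → (∃ a z b, P a z b ∧ (a.natAbs = m ∨ b.natAbs = m)) →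
        Nat.find hex ≤ m := fun m hm h => Nat.find_min' hex ⟨hm, h⟩
    rcases hab with hab | hab
    · obtain ⟨b'', h⟩ := exists_offdiag_zero_of_min (fun a z b => P b z a)
        (fun a z b u h => h2 b z a u h) (a := b') (b := a') (by omega) hP' fun b'' z'' h hb => by
          have := hmin b''.natAbs (by omega) ⟨_, _, _, h, Or.inr rfl⟩
          rw [Int.abs_eq_natAbs, Int.abs_eq_natAbs]
          omega
      exact ⟨_, _, h⟩
    · obtain ⟨b'', h⟩ := exists_offdiag_zero_of_min P h1 (a := a') (b := b') (by omega) hP'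
        fun b'' z'' h hb => by
          have := hmin b''.natAbs (by omega) ⟨_, _, _, h, Or.inl rfl⟩
          rw [Int.abs_eq_natAbs, Int.abs_eq_natAbs]
          omega
      exact ⟨_, _, h⟩
  · push Not at hex
    have h0 : ∀ a z b, P a z b → a = 0 ∧ b = 0 := fun a z b h => by
      constructor <;> by_contra hne
      · exact (hex a.natAbs (by omega) a z b h).1 rfl
      · exact (hex b.natAbs (by omega) a z b h).2 rfl
    obtain ⟨rfl, rfl⟩ := h0 _ _ _ hP
    obtain ⟨y, rfl⟩ := dvd_of_null 0 z fun u _ _ _ => by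
      have := (h0 _ _ _ (h1 _ _ _ u hP)).1
      simp at this
      simp [this]
    exact ⟨0, 0, by simpa using hP⟩

/-- A diagonal matrix with coprime entries is equivalent to one with an entry `1`. -/
theorem diag_one_of_isCoprime (P : ℤ → C → ℤ → Prop)
    (h1 : ∀ a z b u, P a z b → P (a + pair u z + CompOps.norm u * b) (z + b • u) b)
    (h2 : ∀ a z b u, P a z b → P a (z + a • u) (b + pair u z + CompOps.norm u * a))
    {a b : ℤ} (hP : P a 0 b) (hab : IsCoprime a b) : P 1 0 (a * b) := by
  obtain ⟨p, q, hpq⟩ := hab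
  obtain ⟨e, f, he, hf, hef⟩ := exists_hyperbolic (C := C)
  -- As `e` is null and `p a + q b = 1`, these two moves put `e` off the diagonal without changing
  -- `a` and `b`.
  have s1 := h1 _ _ _ (q • e) hP
  have s2 := h2 _ _ _ (p • e) s1
  have s3 : P a e b := by
    convert s2 using 1
    · simp [pair_zero_right, SplitComposition.norm_zsmul, he]
    · rw [zero_add, smul_smul, smul_smul, ← add_smul]
      simp [pair_zero_right, SplitComposition.norm_zsmul, he]
      rw [show b * q + a * p = 1 by linarith, one_smul]
    · simp [pair_zero_right, pair_zsmul_left, pair_zsmul_right, SplitComposition.norm_zsmul, he,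
        pair_self]
  -- Since `f` is null and `⟨f, e⟩ = 1`, this changes `a` into 1. The new off-diagonal entry `e + b
  -- (1 - a) f` has norm `b (1 - a)`; clearing it against the pivot 1 leaves `b - b (1 - a) = a b`.
  have s4 := h1 _ _ _ ((1 - a) • f) s3
  have s5 := h2 _ _ _ (-(e + b • (1 - a) • f)) s4
  convert s5 using 1 <;>
    simp only [pair_zsmul_left, pair_zsmul_right, SplitComposition.norm_zsmul, he, hf, pair_comm f e,
      hef, pair_neg_left, pair_self, SplitComposition.norm_neg, norm_add]
  · ring
  · module
  · ring

end SplitComposition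

theorem Herm3.eta {C : Type} (A : Herm3 C) :
    A = (![A.1 0, A.1 1, A.1 2], ![A.2 0, A.2 1, A.2 2]) := by
  apply Herm3.ext_fin <;> rfl

/-- Hermitian matrices related by the elementary transformations which fix `α` and `β` in
`(α, β, A, 0)`. -/
def HermRel {C : Type} [CompOps C] [AddCommGroup C] [SplitComposition C] (A B : Herm3 C) : Prop :=
  ∀ α β : ℤ, ElemRel (α, β, A, 0) (α, β, B, 0)

namespace HermRel

variable {C : Type} [CompOps C] [AddCommGroup C] [SplitComposition C] {A B D : Herm3 C}

theorem refl (A : Herm3 C) : HermRel A A := fun _ _ => ElemRel.refl _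

theorem trans (h : HermRel A B) (h' : HermRel B D) : HermRel A D :=
  fun α β => (h α β).trans (h' α β)

theorem rotate (A : Herm3 C) : HermRel A A.rotate := fun _ _ => ElemRel.rotate _

theorem shear (u : C) (A : Herm3 C) : HermRel A (A.shear u) := fun α β => by
  have h := ElemRel.shear u (α, β, A, 0)
  rwa [show Herm3.coshear u 0 = 0 from
    map_zero (AddMonoidHom.mk' (Herm3.coshear u) (Herm3.coshear_add u))] at h

theorem coshear (u : C) (A : Herm3 C) : HermRel A (A.coshear u) := fun α β => by
  have h := ElemRel.coshear u (α, β, A, 0)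
  rwa [show Herm3.shear u 0 = 0 from
    map_zero (AddMonoidHom.mk' (Herm3.shear u) (Herm3.shear_add u))] at h

variable (a b c : ℤ) (x y z u : C)

theorem rotate_mk : HermRel (![a, b, c], ![x, y, z]) (![b, c, a], ![y, z, x]) := by
  have h := rotate (![a, b, c], ![x, y, z])
  rwa [show Herm3.rotate (![a, b, c], ![x, y, z]) = (![b, c, a], ![y, z, x]) by
    apply Herm3.ext_fin <;> rfl] at h

theorem rotate_rotate_mk : HermRel (![a, b, c], ![x, y, z]) (![c, a, b], ![z, x, y]) :=
  (rotate_mk _ _ _ _ _ _).trans (rotate_mk _ _ _ _ _ _)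

theorem shear_mk : HermRel (![a, b, c], ![x, y, z])
    (![a, b + pair u x + CompOps.norm u * c, c], ![x + c • u, y, z + conj (u ⋆ y)]) :=
  shear u (![a, b, c], ![x, y, z])

theorem coshear_mk : HermRel (![a, b, c], ![x, y, z])
    (![a, b, c + pair u x + CompOps.norm u * b], ![x + b • u, y + conj (z ⋆ u), z]) := by
  have h := coshear (-u) (![a, b, c], ![x, y, z])
  simpa [Herm3.coshear, pair_neg_left, SplitComposition.norm_neg, SplitComposition.mul_neg,
    conj_neg] using h

theorem coshear_one_mk : HermRel (![a, b, c], ![x, y, z])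
    (![a + pair u y + CompOps.norm u * c, b, c], ![x, y + c • u, z + conj (x ⋆ u)]) :=
  ((rotate_mk _ _ _ _ _ _).trans (coshear_mk _ _ _ _ _ _ u)).trans (rotate_rotate_mk _ _ _ _ _ _)

theorem shear_two_mk : HermRel (![a, b, c], ![x, y, z])
    (![a + pair u z + CompOps.norm u * b, b, c], ![x, y + conj (u ⋆ x), z + b • u]) :=
  ((rotate_rotate_mk _ _ _ _ _ _).trans (shear_mk _ _ _ _ _ _ u)).trans (rotate_mk _ _ _ _ _ _)

theorem coshear_two_mk : HermRel (![a, b, c], ![x, y, z])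
    (![a, b + pair u z + CompOps.norm u * a, c], ![x + conj (y ⋆ u), y, z + a • u]) :=
  ((rotate_rotate_mk _ _ _ _ _ _).trans (coshear_mk _ _ _ _ _ _ u)).trans (rotate_mk _ _ _ _ _ _)

variable {a b c} {z}

theorem shear_two_block (h : HermRel A (![a, b, c], ![0, 0, z])) :
    HermRel A (![a + pair u z + CompOps.norm u * b, b, c], ![0, 0, z + b • u]) := by
  simpa [SplitComposition.mul_zero, conj_zero] using h.trans (shear_two_mk _ _ _ _ _ _ u)

theorem coshear_two_block (h : HermRel A (![a, b, c], ![0, 0, z])) :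
    HermRel A (![a, b + pair u z + CompOps.norm u * a, c], ![0, 0, z + a • u]) := by
  simpa [SplitComposition.zero_mul, conj_zero] using h.trans (coshear_two_mk _ _ _ _ _ _ u)

theorem exists_diag_of_block (h : HermRel A (![a, b, c], ![0, 0, z])) :
    ∃ a' b', HermRel A (![a', b', c], ![0, 0, 0]) :=
  exists_offdiag_zero (fun a z b => HermRel A (![a, b, c], ![0, 0, z]))
    (fun _ _ _ u h => shear_two_block u h) (fun _ _ _ u h => coshear_two_block u h) h

theorem diag_one (h : HermRel A (![a, b, c], ![0, 0, 0])) (hab : IsCoprime a b) :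
    HermRel A (![1, a * b, c], ![0, 0, 0]) :=
  diag_one_of_isCoprime (fun a z b => HermRel A (![a, b, c], ![0, 0, z]))
    (fun _ _ _ u h => shear_two_block u h) (fun _ _ _ u h => coshear_two_block u h) h hab

theorem exists_diag (A : Herm3 C) : ∃ a b c : ℤ, HermRel A (![a, b, c], ![0, 0, 0]) := by
  classical
  -- The pivot is a nonzero entry in the last diagonal position of least absolute value. By rotation
  -- it is also minimal against the other two diagonal positions.
  by_cases hex : ∃ n : ℕ, n ≠ 0 ∧ ∃ B, HermRel A B ∧ (B.1 2).natAbs = n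
  · obtain ⟨hn, B, hB, hBn⟩ := Nat.find_spec hex
    have hmin : ∀ D, HermRel A D → D.1 2 ≠ 0 → (B.1 2).natAbs ≤ (D.1 2).natAbs :=
      fun D h hD => hBn ▸ Nat.find_min' hex ⟨by omega, D, h, rfl⟩
    have hmin0 : ∀ D, HermRel A D → D.1 0 ≠ 0 → |B.1 2| ≤ |D.1 0| := fun D h hD => by
      rw [Int.abs_eq_natAbs, Int.abs_eq_natAbs]
      exact_mod_cast hmin _ (h.trans (rotate D)) hD
    have hmin1 : ∀ D, HermRel A D → D.1 1 ≠ 0 → |B.1 2| ≤ |D.1 1| := fun D h hD =>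
      hmin0 _ (h.trans (rotate D)) hD
    have hc : B.1 2 ≠ 0 := by omega
    clear hBn hn
    rw [B.eta] at hB hmin0 hmin1 hc
    generalize B.1 0 = a, B.1 1 = b, B.1 2 = c, B.2 0 = x, B.2 1 = y, B.2 2 = z at *
    simp only [Matrix.cons_val] at hmin0 hmin1 hc
    obtain ⟨u, rfl⟩ := exists_smul_eq_of_min hc fun u hu =>
      hmin1 _ (hB.trans (shear_mk _ _ _ _ _ _ u)) hu
    have hB1 := hB.trans (shear_mk _ _ _ _ _ _ (-u))
    rw [smul_neg, add_neg_cancel] at hB1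
    generalize b + pair (-u) (c • u) + CompOps.norm (-u) * c = b' at hB1
    -- Clearing `y` leaves the vanishing entry `x` alone; only the `2 × 2` block of `a, z, b` then
    -- remains.
    obtain ⟨v, rfl⟩ := exists_smul_eq_of_min hc fun u hu =>
      hmin0 _ (hB1.trans (coshear_one_mk _ _ _ _ _ _ u)) hu
    have hB2 := hB1.trans (coshear_one_mk _ _ _ _ _ _ (-v))
    rw [smul_neg, add_neg_cancel] at hB2
    rw [SplitComposition.zero_mul, conj_zero] at hB2
    obtain ⟨a', b', h⟩ := exists_diag_of_block hB2
    exact ⟨a', b', c, h⟩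
  · push Not at hex
    have h2 : ∀ D, HermRel A D → D.1 2 = 0 := fun D h => by
      by_contra hne
      exact hex _ (by omega) D h rfl
    obtain ⟨B, rfl⟩ := Herm3.exists_smul_eq_of_closed {D | HermRel A D} 0
      (fun D h => h.trans (rotate D)) (fun D h u => h.trans (shear u D))
      (fun D h => by
        have := h2 _ ((h.trans (rotate D)))
        exact (zero_dvd_iff.2 this)) A (refl A)
    refine ⟨0, 0, 0, ?_⟩
    rw [show (![0, 0, 0], ![0, 0, 0]) = (0 : ℤ) • B by apply Herm3.ext_fin <;> simp]
    exact refl _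

end HermRel

/-! ### Reduction of elements of the Freudenthal module. -/

namespace ElemRel

variable {C : Type} [CompOps C] [AddCommGroup C] [SplitComposition C]

/-- Every `B + α C` can be reached from `(α, β, A, B)`. -/
theorem exists_add_smul (x : FModule C) (D : Herm3 C) :
    ∃ β A, ElemRel x (x.1, β, A, x.2.2.2 + x.1 • D) := by
  -- Quantifying over all `x` makes `S` closed under sums; it is also closed under rotation and
  -- shears, by conjugation. It therefore suffices to start from the multiples of one idempotent.
  let S : Herm3 C → Prop := fun D => ∀ x, ∃ β A, ElemRel x (x.1, β, A, x.2.2.2 + x.1 • D)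
  have hadd : ∀ D E, S D → S E → S (D + E) := fun D E hD hE x => by
    obtain ⟨β, A, h⟩ := hD x
    obtain ⟨β', A', h'⟩ := hE (x.1, β, A, x.2.2.2 + x.1 • D)
    exact ⟨β', A', by simpa [add_assoc] using h.trans h'⟩
  have hrot : ∀ D, S D.rotate → S D := fun D hD x => by
    obtain ⟨β, A, h⟩ := hD (x.1, x.2.1, x.2.2.1.rotate, x.2.2.2.rotate)
    refine ⟨β, A.rotate.rotate, ?_⟩
    rw [show x.2.2.2 + x.1 • D = (x.2.2.2.rotate + x.1 • D.rotate).rotate.rotate by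
      apply Herm3.ext_fin <;> rfl]
    exact (((rotate x).trans h).trans (rotate _)).trans (rotate _)
  have hshear : ∀ D u, S D → S (D.shear u) := fun D u hD x => by
    obtain ⟨β, A, h⟩ := hD (x.1, x.2.1, x.2.2.1.coshear (-u), x.2.2.2.shear (-u))
    refine ⟨β, A.coshear u, (coshear (-u) x).trans (h.trans ?_)⟩
    convert coshear u _ using 4
    simp only
    rw [Herm3.shear_add, Herm3.shear_shear, add_neg_cancel, Herm3.shear_zero]
    congr 1
    exact (map_zsmul (AddMonoidHom.mk' (Herm3.shear u) (Herm3.shear_add u)) x.1 D).symm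
  have e0 : ∀ t : ℤ, S (![t, 0, 0], ![0, 0, 0]) := fun t x => by
    have h := cotransl t x
    rw [show ((![x.2.2.2.1 0 + t * x.1, x.2.2.2.1 1, x.2.2.2.1 2], x.2.2.2.2) : Herm3 C) =
      x.2.2.2 + x.1 • (![t, 0, 0], ![0, 0, 0]) by apply Herm3.ext_fin <;> simp [mul_comm]] at h
    exact ⟨_, _, h⟩
  have e1 : ∀ t : ℤ, S (![0, t, 0], ![0, 0, 0]) := fun t => hrot _ (by
    convert e0 t using 1
    apply Herm3.ext_fin <;> rfl)
  have e2 : ∀ t : ℤ, S (![0, 0, t], ![0, 0, 0]) := fun t => hrot _ (by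
    convert e1 t using 1
    apply Herm3.ext_fin <;> rfl)
  -- A shear of the third idempotent is that idempotent plus `u` off the diagonal plus `n(u)` times
  -- the second idempotent; the two diagonal terms are then subtracted.
  have f0 : ∀ u : C, S (![0, 0, 0], ![u, 0, 0]) := fun u => by
    convert hadd _ _ (hshear _ u (e2 1)) (hadd _ _ (e1 (-CompOps.norm u)) (e2 (-1))) using 1
    apply Herm3.ext_fin <;>
      simp [Herm3.shear, pair_zero_right, SplitComposition.mul_zero, conj_zero]
  have f1 : ∀ u : C, S (![0, 0, 0], ![0, u, 0]) := fun u => hrot _ (by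
    convert f0 u using 1
    apply Herm3.ext_fin <;> rfl)
  have f2 : ∀ u : C, S (![0, 0, 0], ![0, 0, u]) := fun u => hrot _ (by
    convert f1 u using 1
    apply Herm3.ext_fin <;> rfl)
  have hS : S D := by
    convert hadd _ _ (hadd _ _ (hadd _ _ (e0 (D.1 0)) (e1 (D.1 1))) (e2 (D.1 2)))
      (hadd _ _ (hadd _ _ (f0 (D.2 0)) (f1 (D.2 1))) (f2 (D.2 2))) using 1
    apply Herm3.ext_fin <;> simp
  exact hS x

/-- Translation by the first idempotent followed by the removal of `B`. -/
theorem shift (t α β a b c : ℤ) :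
    ElemRel (C := C) (α, β, (![a, α * b, α * c], ![0, 0, 0]), 0)
      (α, β - 2 * t * (α * b * c),
        (![a + t * β - t ^ 2 * (α * b * c), α * b, α * c], ![0, 0, 0]), 0) := by
  -- After this move `B` is `diag(0, tαc, tαb)`. Its entries are multiples of `α`, so opposite
  -- translations by `-tc` and `-tb` remove them; together they subtract `2tαbc` from `β`.
  have h1 := transl (C := C) t (α, β, (![a, α * b, α * c], ![0, 0, 0]), 0)
  have h2 := h1.trans (rotate _)
  have h3 := h2.trans (cotransl (-(t * c)) _)
  have h4 := h3.trans (rotate _)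
  have h5 := h4.trans (cotransl (-(t * b)) _)
  have h6 := h5.trans (rotate _)
  convert h6 using 1
  apply FModule.ext_fin
  · simp [FModule.transl_apply]
  · simp [FModule.transl_apply, Herm3.rotate]; ring
  · apply Herm3.ext_fin <;> simp [FModule.transl_apply, Herm3.rotate]; ring
  · apply Herm3.ext_fin <;> simp [FModule.transl_apply, Herm3.rotate] <;> ring

end ElemRel

namespace ElemRel

variable {C : Type} [CompOps C] [AddCommGroup C] [SplitComposition C]

/-- If `α` vanished on the whole orbit, translating by 1 would show that the first diagonal entry of
`B` does too. Hence `B = 0` throughout the orbit, and the swap then kills `β` and `A`. -/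
theorem exists_fst_ne_zero {x : FModule C} (hx : x ≠ 0) : ∃ y, ElemRel x y ∧ y.1 ≠ 0 := by
  by_contra! h
  apply hx
  have hB : ∀ y, ElemRel x y → y.2.2.2 = 0 := fun y hy => by
    obtain ⟨B, hB⟩ := Herm3.exists_smul_eq_of_closed {B | ∃ y, ElemRel x y ∧ y.2.2.2 = B} 0
      (by rintro _ ⟨y, hy, rfl⟩; exact ⟨_, hy.trans (rotate y), rfl⟩)
      (by rintro _ ⟨y, hy, rfl⟩ u; exact ⟨_, hy.trans (coshear u y), rfl⟩)
      (by
        rintro _ ⟨y, hy, rfl⟩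
        have h1 := h _ hy
        have h2 := h _ (hy.trans (transl 1 y))
        rw [FModule.transl_apply] at h2
        simp only [h1] at h2
        simp [show y.2.2.2.1 0 = 0 by linarith]) y.2.2.2 ⟨y, hy, rfl⟩
    rw [hB, zero_smul]
  have h2 := h _ (swap x)
  exact FModule.ext_fin (h _ (refl x)) (by simpa using h2) (hB _ (swap x)) (hB _ (refl x))

/-- Every nonzero element is equivalent to a diagonal reduced one. -/
theorem exists_reduced {x : FModule C} (hx : x ≠ 0) : ∃ α β a b c : ℤ,
    ElemRel x (α, β, (![a, b, c], ![0, 0, 0]), 0) ∧ 0 < α ∧ α ∣ β ∧ α ∣ a ∧ α ∣ b ∧ α ∣ c := by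
  classical
  have hex : ∃ n : ℕ, n ≠ 0 ∧ ∃ y, ElemRel x y ∧ y.1 = n := by
    obtain ⟨y, hy, hne⟩ := exists_fst_ne_zero hx
    refine ⟨y.1.natAbs, by omega, ?_⟩
    rcases Int.natAbs_eq y.1 with h | h
    · exact ⟨y, hy, h⟩
    · exact ⟨-y, hy.trans (neg y), by rw [Prod.fst_neg]; omega⟩
  obtain ⟨hn, y, hy, hyn⟩ := Nat.find_spec hex
  have hmin : ∀ y, ElemRel x y → 0 < y.1 → (Nat.find hex : ℤ) ≤ y.1 := fun y hy h => by
    have := Nat.find_min' hex (m := y.1.toNat) ⟨by omega, y, hy, by omega⟩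
    omega
  generalize Nat.find hex = n at *
  obtain ⟨α, hα⟩ : ∃ α : ℤ, α = n := ⟨_, rfl⟩
  rw [← hα] at hyn hmin
  have hα0 : 0 < α := by omega
  -- Otherwise an opposite translation replaces the entry by its remainder `r` modulo `α`, and a
  -- translation by `-1` then yields `α - r`, positive and less than the minimum `α`.
  have hb0 : ∀ y, ElemRel x y → y.1 = α → α ∣ y.2.2.2.1 0 := fun y hy hyα => by
    apply Int.dvd_of_emod_eq_zero
    by_contra hne
    have h0 := Int.emod_nonneg (y.2.2.2.1 0) hα0.ne'
    have h1 := Int.emod_lt_of_pos (y.2.2.2.1 0) hα0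
    have h2 := hmin _ ((hy.trans (cotransl (-(y.2.2.2.1 0 / α)) y)).trans (transl (-1) _))
    rw [FModule.transl_apply] at h2
    simp only [Matrix.cons_val, hyα] at h2
    rw [show y.2.2.2.1 0 + -(y.2.2.2.1 0 / α) * α = y.2.2.2.1 0 % α by
      rw [Int.emod_def]; ring] at h2
    have := h2 (by omega)
    omega
  have hB : ∀ y, ElemRel x y → y.1 = α → ∃ D, y.2.2.2 = α • D := fun y hy hyα =>
    Herm3.exists_smul_eq_of_closed {B | ∃ y, ElemRel x y ∧ y.1 = α ∧ y.2.2.2 = B} α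
      (by rintro _ ⟨y, hy, h, rfl⟩; exact ⟨_, hy.trans (rotate y), h, rfl⟩)
      (by rintro _ ⟨y, hy, h, rfl⟩ u; exact ⟨_, hy.trans (coshear u y), h, rfl⟩)
      (by rintro _ ⟨y, hy, h, rfl⟩; exact hb0 y hy h) _ ⟨y, hy, hyα, rfl⟩
  -- Translating by 1 copies `c` and `b` into `B`, whose entries are already known to be divisible
  -- by `α`.
  have hbc : ∀ β a b c : ℤ, ElemRel x (α, β, (![a, b, c], ![0, 0, 0]), 0) → α ∣ b ∧ α ∣ c := by
    intro β a b c h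
    obtain ⟨D, hD⟩ := hB _ (h.trans (transl 1 _)) (by simp [FModule.transl_apply])
    rw [FModule.transl_apply] at hD
    have h1 := congrFun (congrArg Prod.fst hD) 1
    have h2 := congrFun (congrArg Prod.fst hD) 2
    simp at h1 h2
    exact ⟨⟨_, h2⟩, ⟨_, h1⟩⟩
  obtain ⟨D, hD⟩ := hB y hy hyn
  obtain ⟨β, A, h1⟩ := exists_add_smul y (-D)
  rw [hD, hyn, smul_neg, add_neg_cancel] at h1
  obtain ⟨a, b, c, h2⟩ := HermRel.exists_diag A
  have h3 := (hy.trans h1).trans (h2 α β)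
  obtain ⟨⟨b', rfl⟩, ⟨c', rfl⟩⟩ := hbc _ _ _ _ h3
  have ha := (hbc _ _ _ _ (h3.trans (HermRel.rotate_mk _ _ _ _ _ _ α β))).2
  -- The shift by 1 replaces `a` by `a + β - αb'c'`, again divisible by `α`; this yields `α ∣ β`.
  have ha' := (hbc _ _ _ _ ((h3.trans (shift 1 _ _ _ _ _)).trans
    (HermRel.rotate_mk _ _ _ _ _ _ _ _))).2
  refine ⟨α, β, a, _, _, h3, hα0, ?_, ha, dvd_mul_right _ _, dvd_mul_right _ _⟩
  have h4 : α ∣ 1 ^ 2 * (α * b' * c') := ⟨b' * c', by ring⟩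
  have h5 := dvd_add ha' h4
  rw [sub_add_cancel, one_mul] at h5
  exact (dvd_add_right ha).1 h5

end ElemRel

/-! ### Primitivity and the normal form. -/

/-- No prime divides `β` and two of `a`, `b`, `c`. -/
def PairwisePrimitive (β a b c : ℤ) : Prop :=
  ∀ p : ℕ, p.Prime → (p : ℤ) ∣ β →
    ¬((p : ℤ) ∣ a ∧ (p : ℤ) ∣ b) ∧ ¬((p : ℤ) ∣ b ∧ (p : ℤ) ∣ c) ∧ ¬((p : ℤ) ∣ c ∧ (p : ℤ) ∣ a)

theorem Int.gcd_eq_one_iff_forall_prime {a b : ℤ} :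
    Int.gcd a b = 1 ↔ ∀ p : ℕ, p.Prime → (p : ℤ) ∣ a → ¬(p : ℤ) ∣ b := by
  rw [Nat.eq_one_iff_not_exists_prime_dvd]
  refine forall₂_congr fun p _ => ?_
  rw [← Int.natCast_dvd_natCast, Int.dvd_coe_gcd_iff, not_and]

theorem cubeProjective_iff (β a b c : ℤ) :
    CubeProjective 1 β ![a, b, c] 0 ↔ PairwisePrimitive β a b c := by
  have key : ∀ x y z : ℤ, Int.gcd (Int.gcd (1 * x - 0 * 0) (-(x * 0) + y * 0 + z * 0 - 1 * β))
      (β * 0 - y * z) = 1 ↔ ∀ p : ℕ, p.Prime → (p : ℤ) ∣ β →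
        ¬((p : ℤ) ∣ x ∧ (p : ℤ) ∣ y) ∧ ¬((p : ℤ) ∣ z ∧ (p : ℤ) ∣ x) := by
    intro x y z
    rw [Int.gcd_eq_one_iff_forall_prime]
    refine forall₂_congr fun p hp => ?_
    have hp' := Nat.prime_iff_prime_int.1 hp
    simp only [one_mul, MulZeroClass.mul_zero, sub_zero, neg_zero, add_zero, zero_sub, dvd_neg,
      Int.dvd_coe_gcd_iff, hp'.dvd_mul]
    tauto
  constructor
  · intro h p hp hβ
    exact ⟨((key a b c).1 (h 0) p hp hβ).1, ((key b c a).1 (h 1) p hp hβ).1,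
      ((key c a b).1 (h 2) p hp hβ).1⟩
  · intro h i
    fin_cases i
    · exact (key a b c).2 fun p hp hβ => ⟨(h p hp hβ).1, (h p hp hβ).2.2⟩
    · exact (key b c a).2 fun p hp hβ => ⟨(h p hp hβ).2.1, (h p hp hβ).1⟩
    · exact (key c a b).2 fun p hp hβ => ⟨(h p hp hβ).2.2, (h p hp hβ).2.1⟩

/-- Take for `t` the product of the primes dividing `c` but not `a`. For a prime `p ∣ c` exactly one
of `a` and `t` is divisible by `p`, and when `p ∣ a` the hypothesis excludes `p ∣ b`. -/
theorem exists_isCoprime_add_mul {a b c : ℤ} (hc : c ≠ 0)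
    (h : ∀ p : ℕ, p.Prime → (p : ℤ) ∣ b → ¬((p : ℤ) ∣ a ∧ (p : ℤ) ∣ c)) :
    ∃ t : ℤ, IsCoprime (a + t * b) c := by
  classical
  refine ⟨((∏ p ∈ c.natAbs.primeFactors.filter fun p : ℕ => ¬(p : ℤ) ∣ a, p : ℕ) : ℤ), ?_⟩
  rw [Int.isCoprime_iff_gcd_eq_one, Int.gcd_eq_one_iff_forall_prime]
  intro p hp hpa hpc
  have hp' := Nat.prime_iff_prime_int.1 hp
  by_cases h1 : (p : ℤ) ∣ a
  · rw [dvd_add_right h1, hp'.dvd_mul] at hpa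
    rcases hpa with h2 | h2
    · rw [Int.natCast_dvd_natCast, hp.prime.dvd_finsetProd_iff] at h2
      obtain ⟨q, hq, hpq⟩ := h2
      rw [Finset.mem_filter] at hq
      rw [(Nat.prime_dvd_prime_iff_eq hp (Nat.prime_of_mem_primeFactors hq.1)).1 hpq] at h1
      exact hq.2 h1
    · exact h p hp h2 ⟨h1, hpc⟩
  · have h2 : p ∣ ∏ p ∈ c.natAbs.primeFactors.filter fun p : ℕ => ¬(p : ℤ) ∣ a, p :=
      Finset.dvd_prod_of_mem _ (Finset.mem_filter.2 ⟨Nat.mem_primeFactors.2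
        ⟨hp, Int.natCast_dvd.1 hpc, by simpa using hc⟩, h1⟩)
    exact h1 ((dvd_add_left ((Int.natCast_dvd_natCast.2 h2).mul_right b)).1 hpa)

namespace PairwisePrimitive

variable {β a b c : ℤ}

theorem rotate (h : PairwisePrimitive β a b c) : PairwisePrimitive β b c a :=
  fun p hp hβ => ⟨(h p hp hβ).2.1, (h p hp hβ).2.2, (h p hp hβ).1⟩

/-- Each of the three pairs contains `b` or `c`. A prime dividing one of these divides `bc`, so
modulo that prime `β` is unchanged, and so is `a` once `p ∣ β`. -/
theorem shift (h : PairwisePrimitive β a b c) (t : ℤ) :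
    PairwisePrimitive (β - 2 * t * (b * c)) (a + t * β - t ^ 2 * (b * c)) b c := by
  intro p hp hβ
  have hp' := Nat.prime_iff_prime_int.1 hp
  have key : ∀ d : ℤ, (p : ℤ) ∣ d → (d = b ∨ d = c) →
      (p : ℤ) ∣ β ∧ ((p : ℤ) ∣ a + t * β - t ^ 2 * (b * c) → (p : ℤ) ∣ a) := by
    intro d hd hdbc
    have hbc : (p : ℤ) ∣ b * c := by
      rcases hdbc with rfl | rfl
      · exact hd.mul_right _
      · exact hd.mul_left _
    have h1 : (p : ℤ) ∣ β := (dvd_sub_left (hbc.mul_left _)).1 hβ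
    refine ⟨h1, fun h2 => ?_⟩
    rw [dvd_sub_left (hbc.mul_left _)] at h2
    exact (dvd_add_left (h1.mul_left _)).1 h2
  refine ⟨fun ⟨h1, h2⟩ => ?_, fun ⟨h1, h2⟩ => ?_, fun ⟨h1, h2⟩ => ?_⟩
  · obtain ⟨h3, h4⟩ := key b h2 (Or.inl rfl)
    exact (h p hp h3).1 ⟨h4 h1, h2⟩
  · obtain ⟨h3, h4⟩ := key b h1 (Or.inl rfl)
    exact (h p hp h3).2.1 ⟨h1, h2⟩
  · obtain ⟨h3, h4⟩ := key c h1 (Or.inr rfl)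
    exact (h p hp h3).2.2 ⟨h1, h4 h2⟩

theorem merge (h : PairwisePrimitive β a b c) : PairwisePrimitive β 1 (a * b) c := by
  intro p hp hβ
  have hp' := Nat.prime_iff_prime_int.1 hp
  have h1 : ¬(p : ℤ) ∣ 1 := hp'.not_dvd_one
  have := h p hp hβ
  rw [hp'.dvd_mul]
  tauto

/-- A polynomial of degree at most two in `t` that vanishes at `0, 1, 2` has zero coefficients. Then
`β = a = 0` and `b` or `c` vanishes, which contradicts primitivity at any prime. -/
theorem exists_shift_ne_zero (h : PairwisePrimitive β a b c) :
    ∃ t : ℤ, a + t * β - t ^ 2 * (b * c) ≠ 0 := by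
  by_contra! h0
  have e0 := h0 0
  have e1 := h0 1
  have e2 := h0 2
  have hβ : β = 0 := by linarith
  have ha : a = 0 := by linarith
  have hbc : b * c = 0 := by linarith
  subst hβ ha
  have := h 2 Nat.prime_two (by simp)
  rcases mul_eq_zero.1 hbc with rfl | rfl <;> simp at this

end PairwisePrimitive

namespace ElemRel

variable {C : Type} [CompOps C] [AddCommGroup C] [SplitComposition C] {x : FModule C}

theorem diag_rotate {α β a b c : ℤ} (h : ElemRel x (α, β, (![a, b, c], ![0, 0, 0]), 0)) :
    ElemRel x (α, β, (![b, c, a], ![0, 0, 0]), 0) :=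
  h.trans (HermRel.rotate_mk _ _ _ _ _ _ α β)

theorem diag_shift {β a b c : ℤ} (h : ElemRel x (1, β, (![a, b, c], ![0, 0, 0]), 0)) (t : ℤ) :
    ElemRel x (1, β - 2 * t * (b * c),
      (![a + t * β - t ^ 2 * (b * c), b, c], ![0, 0, 0]), 0) := by
  have := shift (C := C) t 1 β a b c
  simp only [one_mul] at this
  exact h.trans this

theorem diag_merge {α β a b c : ℤ} (h : ElemRel x (α, β, (![a, b, c], ![0, 0, 0]), 0))
    (hab : IsCoprime a b) : ElemRel x (α, β, (![1, a * b, c], ![0, 0, 0]), 0) :=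
  h.trans ((HermRel.refl _).diag_one hab α β)

/-- The normal form of a projective element. -/
theorem exists_normal_form {β a b c : ℤ} (h : ElemRel x (1, β, (![a, b, c], ![0, 0, 0]), 0))
    (hP : PairwisePrimitive β a b c) : ∃ ε m : ℤ, (ε = 0 ∨ ε = 1) ∧
      ElemRel x (1, ε, (![1, 1, m], ![0, 0, 0]), 0) := by
  -- A first shift makes one entry nonzero. A second makes a neighbouring entry coprime to it; the
  -- quadratic correction is a multiple of the first entry and does not disturb this. The pair then
  -- merges into a 1 and a product.
  have s1 : ∃ β b c : ℤ, ElemRel x (1, β, (![1, b, c], ![0, 0, 0]), 0) ∧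
      PairwisePrimitive β 1 b c := by
    obtain ⟨s, hs⟩ := hP.exists_shift_ne_zero
    have h1 := (h.diag_shift s).diag_rotate.diag_rotate
    have hP1 := (hP.shift s).rotate.rotate
    obtain ⟨t, ht⟩ := exists_isCoprime_add_mul hs fun p hp hβ => (hP1 p hp hβ).1
    have h2 := h1.diag_shift t
    have hP2 := hP1.shift t
    refine ⟨_, _, _, h2.diag_merge ?_, hP2.merge⟩
    rw [sub_eq_add_neg, show -(t ^ 2 * ((a + s * β - s ^ 2 * (b * c)) * b)) =
      (a + s * β - s ^ 2 * (b * c)) * (-(t ^ 2 * b)) by ring]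
    exact ht.add_mul_left_left _
  clear h hP
  obtain ⟨β, b, c, h, hP⟩ := s1
  have s2 : ∃ β m : ℤ, ElemRel x (1, β, (![m, 1, 1], ![0, 0, 0]), 0) := by
    obtain ⟨s, hs⟩ := hP.rotate.rotate.exists_shift_ne_zero
    have h1 := (h.diag_rotate.diag_rotate.diag_shift s).diag_rotate.diag_rotate
    have hP1 := (hP.rotate.rotate.shift s).rotate.rotate
    obtain ⟨t, ht⟩ := exists_isCoprime_add_mul hs fun p hp hβ => (hP1 p hp hβ).1
    refine ⟨_, _, ((h1.diag_shift t).diag_merge ?_).diag_rotate⟩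
    rw [sub_eq_add_neg, show -(t ^ 2 * ((c + s * β - s ^ 2 * (1 * b)) * 1)) =
      (c + s * β - s ^ 2 * (1 * b)) * (-t ^ 2) by ring]
    exact ht.add_mul_left_left _
  clear h hP
  obtain ⟨β, m, h⟩ := s2
  -- With `bc = 1` a shift by `t` lowers `β` by `2t`.
  have h1 := (h.diag_shift (β / 2)).diag_rotate
  rw [show β - 2 * (β / 2) * (1 * 1) = β % 2 by rw [Int.emod_def]; ring] at h1
  exact ⟨_, _, by omega, h1⟩

end ElemRel

/-! ### Norms and normal forms of projective elements. -/

namespace FModule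

theorem quartic_mod_four {C : Type} [CompOps C] [AddCommGroup C] (x : FModule C) :
    x.quartic ≡ 0 [ZMOD 4] ∨ x.quartic ≡ 1 [ZMOD 4] := by
  rw [quartic_eq]
  generalize Herm3.tracePair x.2.2.1 x.2.2.2 - x.1 * x.2.1 = s
  generalize Herm3.tracePair x.2.2.1.sharp x.2.2.2.sharp = r
  generalize x.2.2.1.cubicNorm = u
  generalize x.2.2.2.cubicNorm = v
  have h : (-4 * r + 4 * x.1 * u + 4 * x.2.1 * v + s ^ 2) % 4 = s ^ 2 % 4 := by
    rw [show -4 * r + 4 * x.1 * u + 4 * x.2.1 * v + s ^ 2 =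
      s ^ 2 + 4 * (-r + x.1 * u + x.2.1 * v) by ring, Int.add_mul_emod_self_left]
  unfold Int.ModEq
  rw [h]
  rcases Int.even_or_odd' s with ⟨k, rfl | rfl⟩
  · left
    rw [show (2 * k) ^ 2 = 4 * k ^ 2 by ring, Int.mul_emod_right]
    rfl
  · right
    rw [show (2 * k + 1) ^ 2 = 1 + 4 * (k ^ 2 + k) by ring, Int.add_mul_emod_self_left]

theorem eta_diag {C : Type} [AddCommGroup C] (α β : ℤ) (a : Fin 3 → ℤ) :
    ((α, β, (a, 0), 0) : FModule C) = (α, β, (![a 0, a 1, a 2], ![0, 0, 0]), 0) := by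
  refine ext_fin rfl rfl ?_ rfl
  apply Herm3.ext_fin <;> rfl

/-- A projective element is in the orbit of some `(1, β, diag(a, b, c), 0)`. -/
theorem IsProjective.exists_eq {C : Type} [CompOps C] [AddCommGroup C] {x : FModule C} (hx : x.IsProjective) :
    ∃ g ∈ FGroup C, ∃ β a b c : ℤ, g x = (1, β, (![a, b, c], ![0, 0, 0]), 0) ∧
      PairwisePrimitive β a b c := by
  obtain ⟨g, hg, α, β, a, hgx, hα, hβ, ha, hP⟩ := hx
  -- `α` divides all three coefficients of a primitive binary form.
  have h1 : α = 1 := by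
    have h0 : α ∣ (1 : ℕ) := by
      rw [← hP 0, Int.dvd_coe_gcd_iff, Int.dvd_coe_gcd_iff]
      simp only [Pi.zero_apply, MulZeroClass.mul_zero, sub_zero, neg_zero, add_zero, zero_sub, dvd_neg]
      exact ⟨⟨dvd_mul_right _ _, dvd_mul_right _ _⟩, (ha _).mul_right _⟩
    exact Int.eq_one_of_dvd_one hα.le (by simpa using h0)
  subst h1
  refine ⟨g, hg, β, a 0, a 1, a 2, by rw [hgx, eta_diag], ?_⟩
  rw [← cubeProjective_iff]
  convert hP using 1
  funext i
  fin_cases i <;> rfl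

variable {C : Type} [CompOps C] [AddCommGroup C] [SplitComposition C]

theorem quartic_diag (α β a b c : ℤ) :
    quartic (C := C) (α, β, (![a, b, c], ![0, 0, 0]), 0) = α ^ 2 * β ^ 2 + 4 * α * (a * b * c) := by
  simp only [quartic_eq, tracePair_sharp]
  simp only [Herm3.cubicNorm, Herm3.tracePair_eq, Matrix.cons_val,
    Prod.fst_zero, Prod.snd_zero, Pi.zero_apply, SplitComposition.mul_zero,
    SplitComposition.norm_zero, pair_zero_right, tr_zero]
  ring

variable (C) in
/-- The standard projective element of norm `n`. -/
def normalForm (n : ℤ) : FModule C := (1, n % 4, (![1, 1, n / 4], ![0, 0, 0]), 0)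

theorem isProjective_of_elemRel {x : FModule C} {β a b c : ℤ}
    (h : ElemRel x (1, β, (![a, b, c], ![0, 0, 0]), 0)) (hP : PairwisePrimitive β a b c) :
    x.IsProjective := by
  obtain ⟨g, hg, h⟩ := h
  refine ⟨g, elementaryGroup.le_FGroup C hg, 1, β, ![a, b, c], ?_, one_pos, one_dvd _,
    fun _ => one_dvd _, (cubeProjective_iff _ _ _ _).2 hP⟩
  rw [h, eta_diag]
  rfl

/-- The norm of the normal form is `ε² + 4m` with `ε ∈ {0, 1}`, so `ε` and `m` are the remainder and
the quotient of `n` by 4. -/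
theorem elemRel_normalForm {x : FModule C} {β a b c n : ℤ}
    (h : ElemRel x (1, β, (![a, b, c], ![0, 0, 0]), 0)) (hP : PairwisePrimitive β a b c)
    (hn : x.quartic = n) : ElemRel x (normalForm C n) := by
  obtain ⟨ε, m, hε, h1⟩ := h.exists_normal_form hP
  have h2 := h1.quartic_eq
  rw [quartic_diag, hn] at h2
  have h3 : n % 4 = ε ∧ n / 4 = m := by
    rcases hε with rfl | rfl <;> constructor <;> omega
  rw [normalForm, h3.1, h3.2]
  exact h1

theorem quartic_normalForm {n : ℤ} (hn : n ≡ 0 [ZMOD 4] ∨ n ≡ 1 [ZMOD 4]) :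
    (normalForm C n).quartic = n := by
  rw [normalForm, quartic_diag]
  rcases hn with hn | hn <;> (unfold Int.ModEq at hn; rw [hn]; norm_num; omega)

theorem isProjective_normalForm (n : ℤ) : (normalForm C n).IsProjective := by
  refine isProjective_of_elemRel (ElemRel.refl _) fun p hp _ => ?_
  have := (Nat.prime_iff_prime_int.1 hp).not_dvd_one
  tauto

end FModule

/-! ### Fundamental discriminants. -/

namespace IsFundamentalDiscriminant

theorem not_sq_dvd_of_odd {n : ℤ} (hn : IsFundamentalDiscriminant n)
    {p : ℕ} (hp : p.Prime) (hp2 : p ≠ 2) : ¬(p : ℤ) ^ 2 ∣ n := by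
  have hp' := Nat.prime_iff_prime_int.1 hp
  intro h
  rcases hn with ⟨hn, -⟩ | ⟨k, rfl, hk, -⟩
  · exact hp'.not_isUnit (hn _ (by rwa [← sq]))
  · have h1 : IsCoprime ((p : ℤ) ^ 2) 4 := by
      rw [show (4 : ℤ) = ((2 : ℕ) : ℤ) ^ 2 by norm_num]
      exact (Nat.isCoprime_iff_coprime.2 ((Nat.coprime_primes hp Nat.prime_two).2 hp2)).pow
    exact hp'.not_isUnit (hk _ (by rw [← sq]; exact h1.dvd_of_dvd_mul_left h))

theorem modEq_of_eq_four_mul {n k : ℤ} (hn : IsFundamentalDiscriminant n)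
    (h : n = 4 * k) : k ≡ 2 [ZMOD 4] ∨ k ≡ 3 [ZMOD 4] := by
  rcases hn with ⟨-, hn⟩ | ⟨m, hm, -, hk⟩
  · unfold Int.ModEq at hn
    omega
  · rwa [show k = m by omega]

theorem ne_zero {n : ℤ} (hn : IsFundamentalDiscriminant n) : n ≠ 0 := by
  rintro rfl
  have := hn.modEq_of_eq_four_mul (k := 0) (by simp)
  simp [Int.ModEq] at this

/-- A prime `p ∣ α` gives `p⁴ ∣ n`; a prime dividing `β` and two of `a, b, c` gives `p² ∣ β²` and
`p² ∣ abc`. For odd `p` this contradicts squarefreeness. For `p = 2`, `n = 4k` with `k ≡ 0` or `1`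
modulo 4, since `k` is a square modulo 4. -/
theorem reduced {n α β a b c : ℤ} (hn : IsFundamentalDiscriminant n)
    (hα : 0 < α) (hβ : α ∣ β) (ha : α ∣ a) (hb : α ∣ b) (hc : α ∣ c)
    (h : α ^ 2 * β ^ 2 + 4 * α * (a * b * c) = n) : α = 1 ∧ PairwisePrimitive β a b c := by
  have hα1 : α = 1 := by
    by_contra hne
    obtain ⟨p, hp, hpα⟩ := Nat.exists_prime_and_dvd (n := α.natAbs) (by omega)
    obtain ⟨α, rfl⟩ := Int.natCast_dvd.2 hpα
    obtain ⟨β, rfl⟩ := hβ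
    obtain ⟨a, rfl⟩ := ha
    obtain ⟨b, rfl⟩ := hb
    obtain ⟨c, rfl⟩ := hc
    by_cases hp2 : p = 2
    · subst hp2
      have := hn.modEq_of_eq_four_mul (k := 4 * (α ^ 4 * (β ^ 2 + 4 * (a * b * c)))) (by
        rw [← h]; push_cast; ring)
      unfold Int.ModEq at this
      omega
    · refine hn.not_sq_dvd_of_odd hp hp2 ⟨p ^ 2 * α ^ 4 * (β ^ 2 + 4 * (a * b * c)), ?_⟩
      rw [← h]
      ring
  subst hα1
  refine ⟨rfl, fun p hp hpβ => ?_⟩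
  have key : ¬(p : ℤ) ^ 2 ∣ a * b * c := by
    rintro ⟨m, hm⟩
    rw [hm] at h
    obtain ⟨β, rfl⟩ := hpβ
    by_cases hp2 : p = 2
    · subst hp2
      have := hn.modEq_of_eq_four_mul (k := β ^ 2 + 4 * m) (by rw [← h]; push_cast; ring)
      unfold Int.ModEq at this
      rcases Int.even_or_odd' β with ⟨k, rfl | rfl⟩
      · rw [show (2 * k) ^ 2 = 4 * k ^ 2 by ring] at this
        omega
      · rw [show (2 * k + 1) ^ 2 = 1 + 4 * (k ^ 2 + k) by ring] at this
        omega
    · refine hn.not_sq_dvd_of_odd hp hp2 ⟨β ^ 2 + 4 * m, ?_⟩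
      rw [← h]
      ring
  refine ⟨fun ⟨⟨a', ha⟩, ⟨b', hb⟩⟩ => key ⟨a' * b' * c, ?_⟩,
    fun ⟨⟨b', hb⟩, ⟨c', hc⟩⟩ => key ⟨a * b' * c', ?_⟩,
    fun ⟨⟨c', hc⟩, ⟨a', ha⟩⟩ => key ⟨a' * b * c', ?_⟩⟩ <;> simp only [ha, hb, hc] <;> ring

end IsFundamentalDiscriminant

theorem FModule.exists_primitive_of_fundamental {C : Type} [CompOps C] [AddCommGroup C]
    [SplitComposition C] {x : FModule C} (hx : IsFundamentalDiscriminant x.quartic) :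
    ∃ β a b c : ℤ, ElemRel x (1, β, (![a, b, c], ![0, 0, 0]), 0) ∧ PairwisePrimitive β a b c := by
  have hx0 : x ≠ 0 := by
    rintro rfl
    apply hx.ne_zero
    exact (congrArg quartic (eta_diag 0 0 0)).trans
      ((quartic_diag (C := C) 0 0 0 0 0).trans (by norm_num))
  obtain ⟨α, β, a, b, c, h, hα, hβ, ha, hb, hc⟩ := ElemRel.exists_reduced hx0
  obtain ⟨rfl, hP⟩ := hx.reduced hα hβ ha hb hc ((quartic_diag _ _ _ _ _).symm.trans h.quartic_eq)
  exact ⟨β, a, b, c, h, hP⟩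

/-! ### Orbits of the full group `FGroup`. -/

theorem projectiveOrbitStructure_FGroup (C : Type) [CompOps C] [AddCommGroup C]
    [SplitComposition C] :
    ProjectiveOrbitStructure (FGroup.rep C) FModule.quartic FModule.IsProjective := by
  have htrans : ∀ n : ℤ, ∀ x y : FModule C, x.IsProjective → x.quartic = n → y.IsProjective →
      y.quartic = n → ∃ g, FGroup.rep C g x = y := by
    -- Here the element of `FGroup` supplied by projectivity may be used as it stands, before the
    -- elementary moves to the normal form.
    have key : ∀ n : ℤ, ∀ x : FModule C, x.IsProjective → x.quartic = n →
        ∃ g ∈ FGroup C, g x = FModule.normalForm C n := by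
      intro n x hx hn
      obtain ⟨g, hg, β, a, b, c, hgx, hP⟩ := hx.exists_eq
      obtain ⟨k, hk, h⟩ := FModule.elemRel_normalForm (hgx ▸ ElemRel.refl (g x)) hP
        ((hg.1 x).trans hn)
      exact ⟨k * g, mul_mem (elementaryGroup.le_FGroup C hk) hg, h⟩
    intro n x y hx hxn hy hyn
    obtain ⟨g, hg, h⟩ := key n x hx hxn
    obtain ⟨k, hk, h'⟩ := key n y hy hyn
    refine ⟨⟨k⁻¹ * g, mul_mem (inv_mem hk) hg⟩, ?_⟩
    change k.symm (g x) = y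
    rw [h, ← h', LinearEquiv.symm_apply_apply]
  have hfund : ∀ n : ℤ, IsFundamentalDiscriminant n → ∀ x : FModule C, x.quartic = n →
      x.IsProjective := by
    rintro n hn x rfl
    obtain ⟨β, a, b, c, h, hP⟩ := FModule.exists_primitive_of_fundamental hn
    exact FModule.isProjective_of_elemRel h hP
  exact
    { norm_invariant := fun g x => g.2.1 x
      norm_mod_four := FModule.quartic_mod_four
      projective_invariant := by
        rintro g x ⟨k, hk, α, β, a, h, h'⟩
        refine ⟨k * g.1⁻¹, mul_mem hk (inv_mem g.2), α, β, a, ?_, h'⟩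
        rw [← h]
        exact congrArg k (g.1.symm_apply_apply x)
      projective_nonempty := fun n hn =>
        ⟨_, FModule.isProjective_normalForm n, FModule.quartic_normalForm hn⟩
      projective_transitive := fun n _ => htrans n
      fundamental_projective := hfund
      fundamental_transitive := fun n hn x y hx hy =>
        htrans n x y (hfund n hn x hx) hx (hfund n hn y hy) hy }

end

/-! ### Comparison with `SL₆(ℤ)` acting on `⋀³ ℤ⁶`. -/

/-- The minor of `M` with rows `i`, `j`, `k` and columns `a`, `b`, `c`. -/
def minorThree (M : Matrix (Fin 6) (Fin 6) ℤ) (i j k a b c : Fin 6) : ℤ :=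
  M i a * M j b * M k c - M i a * M k b * M j c - M j a * M i b * M k c
    + M j a * M k b * M i c + M k a * M i b * M j c - M k a * M j b * M i c

theorem wedgeCoord_wedgeRep (m : SL(6, ℤ)) (i j k a b c : Fin 6) :
    wedgeCoord i j k (wedgeRep m (stdWedge a b c)) = minorThree m i j k a b c := by
  change wedgeCoord i j k (exteriorPower.map 3 (Matrix.toLin' (m : Matrix (Fin 6) (Fin 6) ℤ)) _) = _
  rw [stdWedge, exteriorPower.map_apply_ιMulti, wedgeCoord,
    exteriorPower.alternatingMapLinearEquiv_apply_ιMulti, AlternatingMap.compLinearMap_apply]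
  refine (Matrix.det_fin_three _).trans ?_
  simp [LinearMap.funLeft_apply, minorThree]

theorem thetaInv_wedgeRep (m : SL(6, ℤ)) (a b c : Fin 6) :
    thetaInv (wedgeRep m (stdWedge a b c)) =
      (minorThree m 0 1 2 a b c, minorThree m 3 4 5 a b c,
        (![minorThree m 0 4 5 a b c, minorThree m 1 5 3 a b c, minorThree m 2 3 4 a b c],
          ![(minorThree m 1 3 4 a b c, minorThree m 2 5 3 a b c),
            (minorThree m 2 4 5 a b c, minorThree m 0 3 4 a b c),
            (minorThree m 0 5 3 a b c, minorThree m 1 4 5 a b c)]),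
        (![minorThree m 3 1 2 a b c, minorThree m 4 2 0 a b c, minorThree m 5 0 1 a b c],
          ![(minorThree m 4 0 1 a b c, minorThree m 5 2 0 a b c),
            (minorThree m 5 1 2 a b c, minorThree m 3 0 1 a b c),
            (minorThree m 3 2 0 a b c, minorThree m 4 1 2 a b c)])) := by
  refine FModule.ext_fin ?_ ?_ (Herm3.ext_fin ?_ ?_ ?_ (Prod.ext ?_ ?_) (Prod.ext ?_ ?_)
    (Prod.ext ?_ ?_)) (Herm3.ext_fin ?_ ?_ ?_ (Prod.ext ?_ ?_) (Prod.ext ?_ ?_) (Prod.ext ?_ ?_))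
  all_goals exact wedgeCoord_wedgeRep m _ _ _ a b c

/-- The Hermitian matrix of binarions corresponding to the matrix unit `E i j`. -/
def Herm3.unit (i j : Fin 3) : Herm3 BinZ :=
  ((fun k => if i = k ∧ j = k then 1 else 0),
    (fun k => (if i = k + 1 ∧ j = k + 2 then 1 else 0, if i = k + 2 ∧ j = k + 1 then 1 else 0)))

theorem Herm3.eq_sum_unit (A : Herm3 BinZ) : A = ∑ i, ∑ j, A.toMat i j • Herm3.unit i j := by
  refine Herm3.ext_fin ?_ ?_ ?_ (Prod.ext ?_ ?_) (Prod.ext ?_ ?_) (Prod.ext ?_ ?_) <;>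
    simp [Fin.sum_univ_three, Herm3.toMat, Herm3.unit]

theorem thetaInv_bijective : Function.Bijective thetaInv := by
  have h : Function.LeftInverse thetaInv theta := thetaInv_thetaLin
  have h' : ⇑thetaInv = theta.symm := by
    funext w
    obtain ⟨x, rfl⟩ := theta.surjective w
    rw [LinearEquiv.symm_apply_apply, h x]
  rw [h']
  exact theta.symm.bijective

/-- The transformation `g` of the Freudenthal module corresponds to the matrix `m`. -/
def WedgeMatches (g : FModule BinZ ≃ₗ[ℤ] FModule BinZ) (m : SL(6, ℤ)) : Prop :=
  ∀ x, theta (g x) = wedgeRep m (theta x)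

namespace WedgeMatches

theorem one : WedgeMatches 1 1 := fun x => by simp

theorem mul {g h : FModule BinZ ≃ₗ[ℤ] FModule BinZ} {m k : SL(6, ℤ)} (hg : WedgeMatches g m)
    (hh : WedgeMatches h k) : WedgeMatches (g * h) (m * k) := fun x => by
  rw [map_mul, LinearEquiv.mul_apply, hg, hh]
  rfl

theorem inv {g : FModule BinZ ≃ₗ[ℤ] FModule BinZ} {m : SL(6, ℤ)} (hg : WedgeMatches g m) :
    WedgeMatches g⁻¹ m⁻¹ := fun x => by
  have h := hg (g⁻¹ x)
  rw [show g (g⁻¹ x) = x from g.apply_symm_apply x] at h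
  rw [h, ← Module.End.mul_apply, ← map_mul, inv_mul_cancel, map_one, Module.End.one_apply]

/-- By linearity the comparison reduces to the twenty basis vectors, where it is a finite
computation with `3 × 3` minors. -/
theorem of_basis {g : FModule BinZ ≃ₗ[ℤ] FModule BinZ} {m : SL(6, ℤ)}
    (h0 : thetaInv (wedgeRep m (stdWedge (eIdx 0) (eIdx 1) (eIdx 2))) = g (1, 0, 0, 0))
    (h1 : thetaInv (wedgeRep m (stdWedge (fIdx 0) (fIdx 1) (fIdx 2))) = g (0, 1, 0, 0))
    (hA : ∀ i j : Fin 3, thetaInv (wedgeRep m (stdWedge (eIdx i) (fIdx (j + 1)) (fIdx (j + 2)))) =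
      g (0, 0, Herm3.unit i j, 0))
    (hB : ∀ i j : Fin 3, thetaInv (wedgeRep m (stdWedge (fIdx i) (eIdx (j + 1)) (eIdx (j + 2)))) =
      g (0, 0, 0, Herm3.unit i j)) : WedgeMatches g m := by
  intro x
  apply thetaInv_bijective.1
  change thetaInv (thetaLin (g x)) = thetaInv (wedgeRep m (thetaLin x))
  rw [thetaInv_thetaLin]
  have hx : x = x.1 • (1, 0, 0, 0) + x.2.1 • (0, 1, 0, 0)
      + ∑ i, ∑ j, x.2.2.1.toMat i j • (0, 0, Herm3.unit i j, 0)
      + ∑ i, ∑ j, x.2.2.2.toMat i j • (0, 0, 0, Herm3.unit i j) := by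
    refine FModule.ext_fin ?_ ?_ ?_ ?_
    · simp [Prod.fst_sum]
    · simp [Prod.fst_sum, Prod.snd_sum]
    · conv_lhs => rw [Herm3.eq_sum_unit x.2.2.1]
      simp [Prod.fst_sum, Prod.snd_sum]
    · conv_lhs => rw [Herm3.eq_sum_unit x.2.2.2]
      simp [Prod.snd_sum]
  conv_lhs => rw [hx]
  simp only [thetaLin, LinearMap.coe_mk, AddHom.coe_mk, map_add, map_sum, map_smul, h0, h1, hA, hB]

end WedgeMatches

open Matrix.SpecialLinearGroup

/-- The cyclic shift of `e₁, e₂, e₃` and of `f₁, f₂, f₃`. -/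
def wedgeRotation : SL(6, ℤ) :=
  ⟨!![0, 1, 0, 0, 0, 0; 0, 0, 1, 0, 0, 0; 1, 0, 0, 0, 0, 0;
      0, 0, 0, 0, 1, 0; 0, 0, 0, 0, 0, 1; 0, 0, 0, 1, 0, 0], by
    have h : (!![0, 1, 0, 0, 0, 0; 0, 0, 1, 0, 0, 0; 1, 0, 0, 0, 0, 0;
        0, 0, 0, 0, 1, 0; 0, 0, 0, 0, 0, 1; 0, 0, 0, 1, 0, 0] :
        Matrix (Fin 6) (Fin 6) ℤ) ^ 3 = 1 := by decide +kernel
    have h3 := congrArg Matrix.det h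
    rw [Matrix.det_pow, Matrix.det_one] at h3
    rcases Int.isUnit_iff.1 (IsUnit.of_pow_eq_one h3 three_ne_zero) with h1 | h1
    · exact h1
    · rw [h1] at h3
      norm_num at h3⟩

/-- The map `e i ↦ f i`, `f i ↦ -e i`. -/
def wedgeSwap : SL(6, ℤ) :=
  ⟨!![0, 0, 0, -1, 0, 0; 0, 0, 0, 0, -1, 0; 0, 0, 0, 0, 0, -1;
      1, 0, 0, 0, 0, 0; 0, 1, 0, 0, 0, 0; 0, 0, 1, 0, 0, 0], by
    have h : (!![0, 0, 0, -1, 0, 0; 0, 0, 0, 0, -1, 0; 0, 0, 0, 0, 0, -1;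
        1, 0, 0, 0, 0, 0; 0, 1, 0, 0, 0, 0; 0, 0, 1, 0, 0, 0] : Matrix (Fin 6) (Fin 6) ℤ) =
        Matrix.reindex finSumFinEquiv finSumFinEquiv
          (Matrix.fromBlocks 0 (-1) 1 0 : Matrix (Fin 3 ⊕ Fin 3) (Fin 3 ⊕ Fin 3) ℤ) := by
      decide +kernel
    have h' : (Matrix.fromBlocks 0 (-1) 1 0 : Matrix (Fin 3 ⊕ Fin 3) (Fin 3 ⊕ Fin 3) ℤ) =
        Matrix.fromBlocks 1 (-1) 0 1 * Matrix.fromBlocks 1 0 1 1 *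
          Matrix.fromBlocks 1 (-1) 0 1 := by
      simp [Matrix.fromBlocks_multiply]
    rw [h, Matrix.det_reindex_self, h', Matrix.det_mul, Matrix.det_mul]
    simp⟩

namespace WedgeMatches

set_option synthInstance.maxSize 10000 in
theorem transl : WedgeMatches (FModule.transl BinZ 1)
    (elementary (i := 0) (j := 3) (by decide) 1) := by
  refine of_basis ?_ ?_ (fun i j => ?_) (fun i j => ?_) <;> rw [thetaInv_wedgeRep]
  · decide +kernel
  · decide +kernel
  · revert i j; decide +kernel
  · revert i j; decide +kernel

set_option synthInstance.maxSize 10000 in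
theorem shear_left : WedgeMatches (FModule.shear ((1, 0) : BinZ))
    (elementary (i := 1) (j := 2) (by decide) 1) := by
  refine of_basis ?_ ?_ (fun i j => ?_) (fun i j => ?_) <;> rw [thetaInv_wedgeRep]
  · decide +kernel
  · decide +kernel
  · revert i j; decide +kernel
  · revert i j; decide +kernel

-- The two components of a binarion act separately, on rows and on columns of the `3 × 3` matrix.
-- Columns are indexed by pairs `f ∧ f`, on which the action is contragredient; hence the transposed
-- position and the sign.
set_option synthInstance.maxSize 10000 in
theorem shear_right : WedgeMatches (FModule.shear ((0, 1) : BinZ))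
    (elementary (i := 5) (j := 4) (by decide) (-1)) := by
  refine of_basis ?_ ?_ (fun i j => ?_) (fun i j => ?_) <;> rw [thetaInv_wedgeRep]
  · decide +kernel
  · decide +kernel
  · revert i j; decide +kernel
  · revert i j; decide +kernel

set_option synthInstance.maxSize 10000 in
theorem rotate : WedgeMatches (FModule.rotate BinZ) wedgeRotation := by
  refine of_basis ?_ ?_ (fun i j => ?_) (fun i j => ?_) <;> rw [thetaInv_wedgeRep]
  · decide +kernel
  · decide +kernel
  · revert i j; decide +kernel
  · revert i j; decide +kernel

set_option synthInstance.maxSize 10000 in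
theorem swap : WedgeMatches (FModule.swap BinZ) wedgeSwap := by
  refine of_basis ?_ ?_ (fun i j => ?_) (fun i j => ?_) <;> rw [thetaInv_wedgeRep]
  · decide +kernel
  · decide +kernel
  · revert i j; decide +kernel
  · revert i j; decide +kernel

/-- The transformations which correspond to some matrix. -/
def domain : Subgroup (FModule BinZ ≃ₗ[ℤ] FModule BinZ) where
  carrier := {g | ∃ m, WedgeMatches g m}
  mul_mem' := fun ⟨_, hg⟩ ⟨_, hh⟩ => ⟨_, hg.mul hh⟩
  one_mem' := ⟨_, one⟩
  inv_mem' := fun ⟨_, hg⟩ => ⟨_, hg.inv⟩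

/-- Translations and shears are additive in their parameter, so all of them are products of integral
powers of the three computed cases. -/
theorem elementaryGroup_le_domain : elementaryGroup BinZ ≤ domain := by
  refine (elementaryGroup.le_iff _ _).2 ⟨⟨_, swap⟩, ⟨_, rotate⟩, fun t => ?_, fun u => ?_⟩
  · have hmul : ∀ s t, FModule.transl BinZ s * FModule.transl BinZ t =
        FModule.transl BinZ (s + t) := fun s t =>
      LinearEquiv.ext fun x => FModule.translFun_translFun s t x
    have h0 : FModule.transl BinZ 0 = 1 := LinearEquiv.ext fun x => FModule.translFun_zero x
    let φ : Multiplicative ℤ →* (FModule BinZ ≃ₗ[ℤ] FModule BinZ) :=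
      { toFun := fun t => FModule.transl BinZ t.toAdd
        map_one' := h0
        map_mul' := fun s t => (hmul _ _).symm }
    have h : φ (Multiplicative.ofAdd 1 ^ t) ∈ domain := by
      rw [map_zpow]
      exact zpow_mem (show φ _ ∈ domain from ⟨_, transl⟩) t
    rwa [← ofAdd_zsmul, smul_eq_mul, mul_one] at h
  · have hmul : ∀ u v : BinZ, FModule.shear u * FModule.shear v = FModule.shear (u + v) :=
      fun u v => LinearEquiv.ext fun x => by
        simp [FModule.shear_apply, Herm3.shear_shear, Herm3.coshear_coshear]
    have h0 : FModule.shear (0 : BinZ) = 1 := LinearEquiv.ext fun x => by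
      simp [FModule.shear_apply, Herm3.shear_zero, Herm3.coshear_zero]
    let φ : Multiplicative BinZ →* (FModule BinZ ≃ₗ[ℤ] FModule BinZ) :=
      { toFun := fun u => FModule.shear u.toAdd
        map_one' := h0
        map_mul' := fun s t => (hmul _ _).symm }
    have h : φ (Multiplicative.ofAdd (1, 0) ^ u.1 * Multiplicative.ofAdd (0, 1) ^ u.2) ∈
        domain := by
      rw [map_mul, map_zpow, map_zpow]
      exact mul_mem (zpow_mem (show φ _ ∈ domain from ⟨_, shear_left⟩) _)
        (zpow_mem (show φ _ ∈ domain from ⟨_, shear_right⟩) _)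
    rwa [← ofAdd_zsmul, ← ofAdd_zsmul, ← ofAdd_add, show u.1 • ((1, 0) : BinZ) + u.2 • (0, 1) = u
      from Prod.ext (by simp) (by simp)] at h

/-- The matrices which correspond to some element of `FGroup BinZ`. -/
def range : Subgroup SL(6, ℤ) where
  carrier := {m | ∃ g ∈ FGroup BinZ, WedgeMatches g m}
  mul_mem' := fun ⟨_, hg, h⟩ ⟨_, hg', h'⟩ => ⟨_, mul_mem hg hg', h.mul h'⟩
  one_mem' := ⟨_, one_mem _, one⟩
  inv_mem' := fun ⟨_, hg, h⟩ => ⟨_, inv_mem hg, h.inv⟩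

/-- Conjugating the known transvections by the rotation and the swap gives a directed 6-cycle of
transvections; commutators along the cycle produce all the others. -/
theorem range_eq_top : range = ⊤ := by
  have hr : wedgeRotation ∈ range := ⟨_, FModule.rotate_mem, rotate⟩
  have hs : wedgeSwap ∈ range := ⟨_, FModule.swap_mem, swap⟩
  have h03 : elementary (n := 6) (i := 0) (j := 3) (by decide) 1 ∈ range :=
    ⟨_, FModule.transl_mem 1, transl⟩
  have h12 : elementary (n := 6) (i := 1) (j := 2) (by decide) 1 ∈ range :=
    ⟨_, FModule.shear_mem _, shear_left⟩
  have conj : ∀ {r a b : SL(6, ℤ)}, r ∈ range → a ∈ range →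
      (b : Matrix (Fin 6) (Fin 6) ℤ) * r = r * a → b ∈ range := fun {r a b} hr ha h => by
    have h' : b * r = r * a := Subtype.ext h
    rw [← eq_mul_inv_iff_mul_eq] at h'
    rw [h']
    exact mul_mem (mul_mem hr ha) (inv_mem hr)
  have neg_one : ∀ {i j : Fin 6} (h : i ≠ j), elementary h (-1) ∈ range →
      elementary h 1 ∈ range := fun {i j} h hm => by
    have h1 : elementary h 1 * elementary h (-1) = 1 := Subtype.ext <|
      (Matrix.transvection_mul_transvection_same i j h 1 (-1)).trans (by simp)
    rw [eq_inv_of_mul_eq_one_left h1]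
    exact inv_mem hm
  have h54 : elementary (n := 6) (i := 5) (j := 4) (by decide) 1 ∈ range :=
    neg_one _ ⟨_, FModule.shear_mem _, shear_right⟩
  have h01 : elementary (n := 6) (i := 0) (j := 1) (by decide) 1 ∈ range :=
    conj hr h12 (by decide +kernel)
  have h43 : elementary (n := 6) (i := 4) (j := 3) (by decide) 1 ∈ range :=
    conj hr h54 (by decide +kernel)
  have h25 : elementary (n := 6) (i := 2) (j := 5) (by decide) 1 ∈ range :=
    conj hr h03 (by decide +kernel)
  have h30 : elementary (n := 6) (i := 3) (j := 0) (by decide) 1 ∈ range :=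
    neg_one _ (conj hs h03 (by decide +kernel))
  refine eq_top_of_elementary_mem fun i j h c => elementary_zsmul h ?_ c
  -- The order of the basis along the cycle `0 → 1 → 2 → 5 → 4 → 3 → 0`; in terms of positions in
  -- `Fin 6` its edges are `a → a + 1`.
  let σ : Fin 6 → Fin 6 := ![0, 1, 2, 5, 4, 3]
  have hσ : ∀ a b : Fin 6, a ≠ b → σ a ≠ σ b := by decide
  have hσ' : ∀ a : Fin 6, σ (σ a) = a := by decide
  have d1 : ∀ (a b : Fin 6) (h : σ a ≠ σ b), b = a + 1 → elementary h 1 ∈ range := by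
    rintro a b h rfl
    fin_cases a
    exacts [h01, h12, h25, h54, h43, h30]
  have step : ∀ d : Fin 6, d ≠ 0 → d + 1 ≠ 0 →
      (∀ (a b : Fin 6) (h : σ a ≠ σ b), b = a + d → elementary h 1 ∈ range) →
      ∀ (a b : Fin 6) (h : σ a ≠ σ b), b = a + (d + 1) → elementary h 1 ∈ range :=
    fun d hd hd' ih a b h hb =>
      elementary_trans (hσ a (a + d) (by simpa using hd)) (hσ (a + d) b (by simp [hb])) h
        (ih a _ _ rfl) (d1 _ b _ (by rw [hb, add_assoc]))
  have d2 := step 1 (by decide) (by decide) d1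
  have d3 := step 2 (by decide) (by decide) d2
  have d4 := step 3 (by decide) (by decide) d3
  have d5 := step 4 (by decide) (by decide) d4
  have key : ∀ (d a b : Fin 6) (h : σ a ≠ σ b), b = a + d → elementary h 1 ∈ range := by
    intro d
    fin_cases d
    exacts [fun a b h hb => absurd (by simp [hb]) h, d1, d2, d3, d4, d5]
  have := key (σ j - σ i) (σ i) (σ j) (by rwa [hσ', hσ']) (by simp)
  simpa only [hσ'] using this

end WedgeMatches

/-! ### Recognising primitivity from the derivative of the quartic form. -/

namespace Herm3

variable {C : Type} [CompOps C] [AddCommGroup C] [SplitComposition C]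

theorem sharp_zsmul (t : ℤ) (A : Herm3 C) : (t • A).sharp = t ^ 2 • A.sharp := by
  rw [sharp_eq, sharp_eq]
  apply ext_fin <;> simp [SplitComposition.norm_zsmul, SplitComposition.zsmul_mul,
    SplitComposition.mul_zsmul, SplitComposition.conj_zsmul, smul_sub, smul_smul] <;>
    first | ring1 | (congr 2 <;> ring1)

theorem tracePair_zsmul_right (t : ℤ) (A B : Herm3 C) :
    tracePair A (t • B) = t * tracePair A B := by
  simp only [tracePair_eq, Prod.smul_fst, Prod.smul_snd, Pi.smul_apply,
    SplitComposition.pair_zsmul_right, smul_eq_mul]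
  ring

theorem cubicNorm_zsmul (t : ℤ) (A : Herm3 C) : (t • A).cubicNorm = t ^ 3 * A.cubicNorm := by
  simp only [cubicNorm, Prod.smul_fst, Prod.smul_snd, Pi.smul_apply,
    SplitComposition.norm_zsmul, SplitComposition.zsmul_mul, SplitComposition.mul_zsmul,
    SplitComposition.tr_zsmul, smul_eq_mul]
  ring

end Herm3

namespace FModule

variable {C : Type} [CompOps C] [AddCommGroup C] [SplitComposition C]

theorem symp_diag (β a b c : ℤ) (y : FModule C) :
    symp (1, β, (![a, b, c], ![0, 0, 0]), 0) y = y.2.1 - β * y.1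
      + (a * y.2.2.2.1 0 + b * y.2.2.2.1 1 + c * y.2.2.2.1 2) := by
  simp [symp_eq, Herm3.tracePair_eq, SplitComposition.pair_zero_left]

/-- First order expansion of the quartic form at a diagonal element. -/
theorem quartic_diag_add (β a b c t : ℤ) (y : FModule C) : t ^ 2 ∣
    quartic ((1, β, (![a, b, c], ![0, 0, 0]), 0) + t • y)
      - quartic (C := C) (1, β, (![a, b, c], ![0, 0, 0]), 0)
      - t * ((4 * (a * b * c) + 2 * β ^ 2) * y.1 + 2 * β * y.2.1
        + 4 * (b * c * y.2.2.1.1 0 + c * a * y.2.2.1.1 1 + a * b * y.2.2.1.1 2)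
        - 2 * β * (a * y.2.2.2.1 0 + b * y.2.2.2.1 1 + c * y.2.2.2.1 2)) := by
  obtain ⟨γ, δ, ⟨d, u⟩, D⟩ := y
  obtain ⟨S, hN⟩ : ∃ S, Herm3.cubicNorm (C := C) ((![a, b, c], ![0, 0, 0]) + t • (d, u)) =
      a * b * c + t * (b * c * d 0 + c * a * d 1 + a * b * d 2) + t ^ 2 * S := by
    refine ⟨a * d 1 * d 2 + b * d 2 * d 0 + c * d 0 * d 1 + t * (d 0 * d 1 * d 2)
      - (a + t * d 0) * CompOps.norm (u 0) - (b + t * d 1) * CompOps.norm (u 1)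
      - (c + t * d 2) * CompOps.norm (u 2)
      + t * CompOps.tr (CompOps.mul (CompOps.mul (u 0) (u 1)) (u 2)), ?_⟩
    simp only [Herm3.cubicNorm, Prod.fst_add, Prod.snd_add, Prod.smul_fst, Prod.smul_snd,
      Pi.add_apply, Pi.smul_apply, Matrix.cons_val, zero_add, smul_eq_mul,
      SplitComposition.norm_zsmul, SplitComposition.zsmul_mul, SplitComposition.mul_zsmul,
      SplitComposition.tr_zsmul]
    ring
  have hT : Herm3.tracePair (C := C) ((![a, b, c], ![0, 0, 0]) + t • (d, u)) D =
      a * D.1 0 + b * D.1 1 + c * D.1 2 + t * Herm3.tracePair (d, u) D := by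
    simp only [Herm3.tracePair_eq, Prod.fst_add, Prod.snd_add, Prod.smul_fst, Prod.smul_snd,
      Pi.add_apply, Pi.smul_apply, Matrix.cons_val, zero_add, smul_eq_mul,
      SplitComposition.pair_zsmul_left]
    ring
  rw [quartic_diag, quartic_eq]
  simp only [Prod.fst_add, Prod.snd_add, Prod.smul_fst, Prod.smul_snd, zero_add, smul_eq_mul]
  rw [hN, Herm3.sharp_zsmul, Herm3.tracePair_zsmul_right, Herm3.tracePair_zsmul_right,
    Herm3.cubicNorm_zsmul, hT]
  generalize Herm3.tracePair (C := C) (d, u) D = V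
  generalize Herm3.tracePair (C := C) _ _ = W
  generalize Herm3.cubicNorm (C := C) _ = M
  generalize hL : b * c * d 0 + c * a * d 1 + a * b * d 2 = L
  generalize hT : a * D.1 0 + b * D.1 1 + c * D.1 2 = T
  exact ⟨-4 * W + 4 * S + 4 * γ * L + 4 * t * γ * S + 4 * (β + t * δ) * t * M
    + (T - δ - γ * β) ^ 2 - 2 * β * (V - γ * δ) + 2 * t * (T - δ - γ * β) * (V - γ * δ)
    + t ^ 2 * (V - γ * δ) ^ 2, by ring⟩

/-- Modulo `4 p`, the derivative of the quartic form at `x` is a multiple of `2 {x, ·}`. -/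
def IsDegenerateAt {C : Type} [CompOps C] [AddCommGroup C] (p : ℕ) (x : FModule C) : Prop :=
  ∃ s : ℤ, ∀ y : FModule C,
    (4 * (p : ℤ)) ^ 2 ∣ quartic (x + (4 * (p : ℤ)) • y) - quartic x + 4 * p * (2 * s * symp x y)

/-- Only the quartic form, the symplectic form and additivity enter the condition, so all of
`FGroup` preserves it. -/
theorem IsDegenerateAt.map {C : Type} [CompOps C] [AddCommGroup C] {p : ℕ} {x : FModule C} (hx : IsDegenerateAt p x)
    {g : FModule C ≃ₗ[ℤ] FModule C} (hg : g ∈ FGroup C) : IsDegenerateAt p (g x) := by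
  obtain ⟨s, hs⟩ := hx
  refine ⟨s, fun y => ?_⟩
  obtain ⟨y, rfl⟩ := g.surjective y
  rw [← map_smul, ← map_add, hg.1, hg.1, hg.2]
  exact hs y

/-- For an increment `4p • y` the terms of order at least two are divisible by `(4p)²`; dividing by
`4p` leaves a congruence for the derivative alone. -/
theorem isDegenerateAt_diag_iff {p : ℕ} (hp : p ≠ 0) (β a b c : ℤ) :
    IsDegenerateAt (C := C) p (1, β, (![a, b, c], ![0, 0, 0]), 0) ↔
      ∃ s : ℤ, ∀ y : FModule C, 4 * (p : ℤ) ∣ (4 * (a * b * c) + 2 * β ^ 2) * y.1 + 2 * β * y.2.1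
        + 4 * (b * c * y.2.2.1.1 0 + c * a * y.2.2.1.1 1 + a * b * y.2.2.1.1 2)
        - 2 * β * (a * y.2.2.2.1 0 + b * y.2.2.2.1 1 + c * y.2.2.2.1 2)
        + 2 * s * (y.2.1 - β * y.1
          + (a * y.2.2.2.1 0 + b * y.2.2.2.1 1 + c * y.2.2.2.1 2)) := by
  have hp0 : 4 * (p : ℤ) ≠ 0 := by positivity
  refine exists_congr fun s => forall_congr' fun y => ?_
  rw [symp_diag, pow_two]
  refine Iff.trans (dvd_iff_dvd_of_dvd_sub ?_) (mul_dvd_mul_iff_left hp0)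
  obtain ⟨r, hr⟩ := quartic_diag_add β a b c (4 * (p : ℤ)) y
  exact ⟨r, by linear_combination hr⟩

/-- The derivative has even coefficients, so a congruence modulo `p` would say nothing at `p = 2`;
the modulus `4p` treats all primes alike. -/
theorem isDegenerateAt_diag {β a b c : ℤ} :
    (∃ p : ℕ, p.Prime ∧ IsDegenerateAt (C := C) p (1, β, (![a, b, c], ![0, 0, 0]), 0)) ↔
      ¬PairwisePrimitive β a b c := by
  constructor
  · rintro ⟨p, hp, h⟩ hP
    obtain ⟨s, h⟩ := (isDegenerateAt_diag_iff hp.ne_zero β a b c).1 h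
    have hp' := Nat.prime_iff_prime_int.1 hp
    -- Testing on the `β`-coordinate determines `s` modulo `2p`; the remaining basis vectors then
    -- give divisibility by `p`.
    obtain ⟨k, hk⟩ : 2 * (p : ℤ) ∣ β + s := by
      obtain ⟨k, hk⟩ := h (0, 1, 0, 0)
      exact ⟨k, by simp at hk; linarith⟩
    obtain rfl : s = 2 * p * k - β := by linarith
    have e0 : (p : ℤ) ∣ a * b * c + β ^ 2 := by
      obtain ⟨l, hl⟩ := h (1, 0, 0, 0)
      exact ⟨l + k * β, by simp at hl; linarith⟩
    have m0 : (p : ℤ) ∣ b * c := by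
      obtain ⟨l, hl⟩ := h (0, 0, (![1, 0, 0], ![0, 0, 0]), 0)
      exact ⟨l, by simp at hl; linarith⟩
    have m1 : (p : ℤ) ∣ c * a := by
      obtain ⟨l, hl⟩ := h (0, 0, (![0, 1, 0], ![0, 0, 0]), 0)
      exact ⟨l, by simp at hl; linarith⟩
    have m2 : (p : ℤ) ∣ a * b := by
      obtain ⟨l, hl⟩ := h (0, 0, (![0, 0, 1], ![0, 0, 0]), 0)
      exact ⟨l, by simp at hl; linarith⟩
    have n0 : (p : ℤ) ∣ β * a := by
      obtain ⟨l, hl⟩ := h (0, 0, 0, (![1, 0, 0], ![0, 0, 0]))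
      exact ⟨k * a - l, by simp at hl; linarith⟩
    have hβ : (p : ℤ) ∣ β := by
      rcases hp'.dvd_or_dvd n0 with h0 | h0
      · exact h0
      · rw [mul_assoc] at e0
        exact hp'.dvd_of_dvd_pow ((dvd_add_right (h0.mul_right _)).1 e0)
    obtain ⟨q0, q1, q2⟩ := hP p hp hβ
    rcases hp'.dvd_or_dvd m0 with h0 | h0
    · rcases hp'.dvd_or_dvd m1 with h1 | h1
      · exact q1 ⟨h0, h1⟩
      · exact q0 ⟨h1, h0⟩
    · rcases hp'.dvd_or_dvd m2 with h1 | h1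
      · exact q2 ⟨h0, h1⟩
      · exact q1 ⟨h1, h0⟩
  · intro hP
    obtain ⟨p, hp, ⟨β, rfl⟩, h⟩ : ∃ p : ℕ, p.Prime ∧ (p : ℤ) ∣ β ∧
        ((p : ℤ) ∣ a * b ∧ (p : ℤ) ∣ b * c ∧ (p : ℤ) ∣ c * a) := by
      unfold PairwisePrimitive at hP
      push Not at hP
      obtain ⟨p, hp, hβ, h⟩ := hP
      refine ⟨p, hp, hβ, ?_⟩
      by_cases h0 : (p : ℤ) ∣ a ∧ (p : ℤ) ∣ b
      · exact ⟨h0.1.mul_right _, h0.2.mul_right _, h0.1.mul_left _⟩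
      by_cases h1 : (p : ℤ) ∣ b ∧ (p : ℤ) ∣ c
      · exact ⟨h1.1.mul_left _, h1.1.mul_right _, h1.2.mul_right _⟩
      have h2 := h (fun h => not_and.1 h0 h) (fun h => not_and.1 h1 h)
      exact ⟨h2.2.mul_right _, h2.1.mul_left _, h2.1.mul_right _⟩
    obtain ⟨⟨u, hu⟩, ⟨v, hv⟩, ⟨w, hw⟩⟩ := h
    -- The multiplier is minus the old `β`, which has been written as `p * β`; the `δ`-terms cancel
    -- and every other coefficient becomes a multiple of `4p`.
    refine ⟨p, hp, (isDegenerateAt_diag_iff hp.ne_zero _ a b c).2 ⟨-(p * β), fun y => ?_⟩⟩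
    rw [hu, hv, hw]
    refine ⟨(u * c + p * β ^ 2) * y.1 + (v * y.2.2.1.1 0 + w * y.2.2.1.1 1 + u * y.2.2.1.1 2)
      - β * (a * y.2.2.2.1 0 + b * y.2.2.2.1 1 + c * y.2.2.2.1 2), by ring⟩

/-- If `α` divides the whole vector, it divides the leading coordinate 1 of the projective
representative. Failure of primitivity would be transported there by invariance of degeneracy. Thus
projectivity shows on any reduced form reached by elementary moves. -/
theorem IsProjective.pairwisePrimitive {x : FModule C} (hx : x.IsProjective) {α β a b c : ℤ}
    (h : ElemRel x (α, β, (![a, b, c], ![0, 0, 0]), 0)) (hα : 0 < α) (hβ : α ∣ β) (ha : α ∣ a)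
    (hb : α ∣ b) (hc : α ∣ c) : α = 1 ∧ PairwisePrimitive β a b c := by
  obtain ⟨g, hg, β', a', b', c', hgx, hP⟩ := hx.exists_eq
  obtain ⟨k, hk, hkx⟩ := h
  have hx : x = k⁻¹ (α, β, (![a, b, c], ![0, 0, 0]), 0) := by
    rw [← hkx]
    exact (k.symm_apply_apply x).symm
  have h1 : α = 1 := by
    obtain ⟨β, rfl⟩ := hβ
    obtain ⟨a, rfl⟩ := ha
    obtain ⟨b, rfl⟩ := hb
    obtain ⟨c, rfl⟩ := hc
    have hs : ((α, α * β, (![α * a, α * b, α * c], ![0, 0, 0]), 0) : FModule C) =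
        α • (1, β, (![a, b, c], ![0, 0, 0]), 0) := by
      apply ext_fin
      · simp
      · simp
      · apply Herm3.ext_fin <;> simp
      · simp
    rw [hx, hs, map_smul, map_smul] at hgx
    have h1 := congrArg Prod.fst hgx
    rw [Prod.smul_fst, smul_eq_mul] at h1
    exact Int.eq_one_of_dvd_one hα.le ⟨_, h1.symm⟩
  subst h1
  refine ⟨rfl, ?_⟩
  by_contra hbad
  obtain ⟨p, hp, hd⟩ := isDegenerateAt_diag (C := C).2 hbad
  refine isDegenerateAt_diag (C := C).1 ⟨p, hp, ?_⟩ hP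
  rw [← hgx, hx]
  exact (hd.map (inv_mem (elementaryGroup.le_FGroup C hk))).map hg

theorem IsProjective.elemRel_normalForm {x : FModule C} (hx : x.IsProjective) {n : ℤ}
    (hn : x.quartic = n) : ElemRel x (normalForm C n) := by
  have hx0 : x ≠ 0 := by
    rintro rfl
    obtain ⟨g, -, β, a, b, c, h, -⟩ := hx.exists_eq
    rw [map_zero] at h
    exact zero_ne_one (congrArg Prod.fst h)
  obtain ⟨α, β, a, b, c, h, hα, hβ, ha, hb, hc⟩ := ElemRel.exists_reduced hx0
  obtain ⟨rfl, hP⟩ := hx.pairwisePrimitive h hα hβ ha hb hc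
  exact FModule.elemRel_normalForm h hP hn

theorem IsProjective.map {C : Type} [CompOps C] [AddCommGroup C] {x : FModule C}
    (hx : x.IsProjective) {g : FModule C ≃ₗ[ℤ] FModule C} (hg : g ∈ FGroup C) :
    (g x).IsProjective := by
  obtain ⟨k, hk, α, β, a, h, h'⟩ := hx
  refine ⟨k * g⁻¹, mul_mem hk (inv_mem hg), α, β, a, ?_, h'⟩
  rw [← h]
  exact congrArg k (g.symm_apply_apply x)

end FModule

/-! ### Orbits of `SL₆(ℤ)` and the conclusion. -/

theorem projectiveOrbitStructure_wedgeRep :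
    ProjectiveOrbitStructure wedgeRep Wedge3.quartic Wedge3.IsProjective := by
  -- Invariance uses that every matrix comes from `FGroup BinZ`; transitivity uses, in `hE`, that
  -- every elementary transformation comes from a matrix.
  have hG : ∀ m w, ∃ g ∈ FGroup BinZ, theta.symm (wedgeRep m w) = g (theta.symm w) := by
    intro m w
    obtain ⟨g, hg, h⟩ : m ∈ WedgeMatches.range := by
      rw [WedgeMatches.range_eq_top]
      trivial
    refine ⟨g, hg, ?_⟩
    rw [LinearEquiv.symm_apply_eq, h, LinearEquiv.apply_symm_apply]
  have hE : ∀ x y : FModule BinZ, ElemRel x y → ∃ m, wedgeRep m (theta x) = theta y := by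
    rintro x y ⟨g, hg, rfl⟩
    obtain ⟨m, hm⟩ := WedgeMatches.elementaryGroup_le_domain hg
    exact ⟨m, (hm x).symm⟩
  have htrans : ∀ n : ℤ, ∀ x y : Wedge3, x.IsProjective → x.quartic = n → y.IsProjective →
      y.quartic = n → ∃ m, wedgeRep m x = y := by
    intro n x y hx hxn hy hyn
    obtain ⟨m, hm⟩ := hE _ _ ((hx.elemRel_normalForm hxn).trans (hy.elemRel_normalForm hyn).symm)
    exact ⟨m, by simpa using hm⟩
  have hfund : ∀ n : ℤ, IsFundamentalDiscriminant n → ∀ x : Wedge3, x.quartic = n →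
      x.IsProjective := by
    rintro n hn x rfl
    obtain ⟨β, a, b, c, h, hP⟩ := FModule.exists_primitive_of_fundamental hn
    exact FModule.isProjective_of_elemRel h hP
  exact
    { norm_invariant := fun m w => by
        obtain ⟨g, hg, h⟩ := hG m w
        rw [Wedge3.quartic, h, hg.1]
        rfl
      norm_mod_four := fun w => FModule.quartic_mod_four _
      projective_invariant := fun m w hw => by
        obtain ⟨g, hg, h⟩ := hG m w
        rw [Wedge3.IsProjective, h]
        exact hw.map hg
      projective_nonempty := fun n hn => by
        refine ⟨theta (FModule.normalForm BinZ n), ?_, ?_⟩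
        · rw [Wedge3.IsProjective, LinearEquiv.symm_apply_apply]
          exact FModule.isProjective_normalForm n
        · rw [Wedge3.quartic, LinearEquiv.symm_apply_apply]
          exact FModule.quartic_normalForm hn
      projective_transitive := fun n _ => htrans n
      fundamental_projective := hfund
      fundamental_transitive := fun n hn x y hx hy =>
        htrans n x y (hfund n hn x hx) hx (hfund n hn y hy) hy }

theorem theorem4 :
    ProjectiveOrbitStructure wedgeRep Wedge3.quartic Wedge3.IsProjective ∧
    ProjectiveOrbitStructure (FGroup.rep QuatZ) FModule.quartic FModule.IsProjective ∧
    ProjectiveOrbitStructure (FGroup.rep OctZ) FModule.quartic FModule.IsProjective :=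
  ⟨projectiveOrbitStructure_wedgeRep, projectiveOrbitStructure_FGroup QuatZ,
    projectiveOrbitStructure_FGroup OctZ⟩
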